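/- All systems are finite-dimensional, logarithms are to base $2$, and for states $\rho,\sigma$ and a set $S$ of states of the same system $$D_{\max}(\rho\|\sigma)=\inf\{\log_2 s : \rho\le s\sigma\}\in[0,\infty],\qquad D_{\max}(\rho\|S)=\inf_{\sigma\in S}D_{\max}(\rho\|\sigma).$$ **Costs.** In a resource theory with a fixed unit state $\Phi$, a rate $r\in\mathbb R$ is *achievable* for $\rho$ if for every $\delta>0$ there are $m\ge 0$, $n\ge 1$ and a free operation $\Lambda$ with $\Lambda(\Phi^{\otimes m})=\rho^{\otimes n}$ and $m/n\le r+\delta$. It is *catalytically achievable* if for every $\delta>0$ there are $m\ge 0$, $n\ge 1$, a catalyst $C$ in a state $\tau$, and a free operation $\Lambda$ with $\operatorname{Tr}_C\Lambda(\Phi^{\otimes m}\otimes\tau)=\rho^{\otimes n}$, $\operatorname{Tr}_S\Lambda(\Phi^{\otimes m}\otimes\tau)=\tau$ and $m/n\le r+\delta$ (here $S$ denotes the output system carrying $\rho^{\otimes n}$). The exact cost $E_c^0(\rho)$ and the catalytic exact cost $E_{c,c}^0(\rho)$ are the infima of the achievable and of the catalytically achievable rates, respectively. **Thermodynamics.**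 Systems carry Hamiltonians $H$, Gibbs states are $e^{-\beta H}/\operatorname{Tr}e^{-\beta H}$ with $\beta>0$ fixed, and composite systems have additive Hamiltonians. The free operations are the (closed) thermal operations: the limits of maps $X\mapsto\operatorname{Tr}_{B'}[U(X\otimes\gamma_B)U^\dagger]$, where $\gamma_B$ is the Gibbs state of a finite-dimensional bath $B$ and $U:A\otimes B\to A'\otimes B'$ is an energy-conserving unitary. The unit $\Phi$ is a pure state $|0\rangle\langle0|$ of a qubit with zero Hamiltonian (worth $kT\ln 2$ of work). The resulting costs are the exact work cost $W_c^0$ and the catalytic exact work cost $W_{c,c}^0$. **(1)** Let $0<p<1/2$ and consider a two-level system with Gibbs state $\gamma=(1-p)|0\rangle\langle0|+p|1\rangle\langle1|$, where $|0\rangle,|1\rangle$ are its energy eigenstates. Every semiclassical (i.e. diagonal) state $\rho$ of it satisfies $W_c^0(\rho)=D_{\max}(\rho\|\gamma)$. In particular $W_c^0(|0\rangle\langle0|)=\log_2\frac1{1-p}$, $W_c^0(\gamma)=0$ and $$W_c^0\big((1-q)|0\rangle\langle0|+q\gamma\big)=\log_2\frac{1-pq}{1-p}\qquad(0\le q\le1).$$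 Hence $W_c^0$ is not midpoint-convex on the segment between $|0\rangle\langle0|$ and $\gamma$: $$W_c^0\big(\tfrac12|0\rangle\langle0|+\tfrac12\gamma\big)>\tfrac12W_c^0(|0\rangle\langle0|)+\tfrac12W_c^0(\gamma),$$ and for $\rho=\tfrac12|0\rangle\langle0|+\tfrac12\gamma$ one has $W_{c,c}^0(\rho)<W_c^0(\rho)$. **(2)** Let $S$ be any set of states of a finite-dimensional system, let $\rho\notin S$ be a state with $D_{\max}(\rho\|S)<\infty$, and let $\sigma^*\in S$ be optimal for $\rho$, i.e. $D_{\max}(\rho\|\sigma^*)=D_{\max}(\rho\|S)$. Then $$\tfrac12D_{\max}(\rho\|S)+\tfrac12D_{\max}(\sigma^*\|S)<D_{\max}\big(\tfrac12\rho+\tfrac12\sigma^*\,\big\|\,S\big).$$ **(3)** Consider any resource theory whose free operations are quantum channels, include the identities, are closed under composition and under acting on part of a composite system, and include the rearrangements of subsystems (including adding or removing a trivial one-dimensional system). Fix any unit state $\Phi$, and let $S$ denote the set of free states of each system, i.e. those that a free operation prepares from the trivial system. Suppose that $E_c^0(\rho)=D_{\max}(\rho\|S)$ for all states $\rho$ of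 all systems or, more generally, for all states in a class that is closed under tensor products and equal mixtures. If $\rho$ is a non-free state (in the class) with $D_{\max}(\rho\|S)<\infty$ and $\sigma^*$ is a free state (in the class) that is optimal for $\rho$, i.e. $D_{\max}(\rho\|\sigma^*)=D_{\max}(\rho\|S)$, then $\bar\rho=\tfrac12\rho+\tfrac12\sigma^*$ satisfies $$E_c^0(\bar\rho)>\tfrac12E_c^0(\rho)+\tfrac12E_c^0(\sigma^*)\qquad\text{and}\qquad E_{c,c}^0(\bar\rho)<E_c^0(\bar\rho).$$ -/

import Mathlib

open scoped Matrix Kronecker ComplexOrder Topology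

noncomputable section

namespace QResource

/-! ### States, channels, max-relative entropy (finite dimension) -/

/-- Density matrices. -/
def IsState {ι : Type*} [Fintype ι] (ρ : Matrix ι ι ℂ) : Prop :=
  ρ.PosSemidef ∧ ρ.trace = 1

/-- Quantum channels: completely positive trace-preserving maps, in Kraus form. -/
def IsChannel {ι κ : Type*} [Fintype ι] [Fintype κ] [DecidableEq ι]
    (Λ : Matrix ι ι ℂ →ₗ[ℂ] Matrix κ κ ℂ) : Prop :=
  ∃ (r : ℕ) (K : Fin r → Matrix κ ι ℂ),
    (∑ i, (K i)ᴴ * K i = 1) ∧ ∀ X, Λ X = ∑ i, K i * X * (K i)ᴴ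

/-- `D_max(ρ‖σ) = inf {log₂ s | ρ ≤ s σ}`, with value `⊤` if there is no such `s`. -/
def Dmax {ι : Type*} (ρ σ : Matrix ι ι ℂ) : EReal :=
  ⨅ (s : ℝ) (_ : 0 < s ∧ ((s : ℂ) • σ - ρ).PosSemidef), ((Real.logb 2 s : ℝ) : EReal)

/-- `D_max(ρ‖S) = inf_{σ ∈ S} D_max(ρ‖σ)`. -/
def DmaxSet {ι : Type*} (ρ : Matrix ι ι ℂ) (S : Set (Matrix ι ι ℂ)) : EReal :=
  ⨅ σ ∈ S, Dmax ρ σ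

/-- The equal mixture `½ρ + ½σ`. -/
def mix {ι : Type*} (ρ σ : Matrix ι ι ℂ) : Matrix ι ι ℂ :=
  (1 / 2 : ℂ) • ρ + (1 / 2 : ℂ) • σ

/-- Partial trace over the second tensor factor. -/
def trSnd {ι κ : Type*} [Fintype κ] (X : Matrix (ι × κ) (ι × κ) ℂ) : Matrix ι ι ℂ :=
  Matrix.of fun i i' => ∑ k, X (i, k) (i', k)

/-- Partial trace over the first tensor factor. -/
def trFst {ι κ : Type*} [Fintype ι] (X : Matrix (ι × κ) (ι × κ) ℂ) : Matrix κ κ ℂ :=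
  Matrix.of fun k k' => ∑ i, X (i, k) (i, k')

/-- The map `Λ ⊗ id`. -/
def tensorId {ι ι' : Type*} (κ : Type*) (Λ : Matrix ι ι ℂ →ₗ[ℂ] Matrix ι' ι' ℂ) :
    Matrix (ι × κ) (ι × κ) ℂ →ₗ[ℂ] Matrix (ι' × κ) (ι' × κ) ℂ where
  toFun X := Matrix.of fun a b => Λ (Matrix.of fun i j => X (i, a.2) (j, b.2)) a.1 b.1
  map_add' X Y := by
    ext a b
    exact congrFun (congrFun (Λ.map_add (Matrix.of fun i j => X (i, a.2) (j, b.2))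
      (Matrix.of fun i j => Y (i, a.2) (j, b.2))) a.1) b.1
  map_smul' c X := by
    ext a b
    exact congrFun (congrFun (Λ.map_smul c (Matrix.of fun i j => X (i, a.2) (j, b.2))) a.1) b.1

/-- The map that relabels the basis along a bijection. -/
def relabel {ι κ : Type*} (e : ι ≃ κ) : Matrix ι ι ℂ →ₗ[ℂ] Matrix κ κ ℂ :=
  (Matrix.reindexLinearEquiv ℂ ℂ e e).toLinearMap

/-! ### Resource theories and asymptotic exact costs -/

/-- A finite-dimensional quantum system: a basis, together with the additional structure that the
resource theory refers to (a Hamiltonian, a bipartition, ...), recorded as a label. -/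
structure Sys (L : Type → Type*) where
  ι : Type
  [fintype : Fintype ι]
  [decEq : DecidableEq ι]
  [nonempty : Nonempty ι]
  label : L ι

attribute [instance] Sys.fintype Sys.decEq Sys.nonempty

/-- The data of a resource theory: which systems there are, how they compose, and which maps
between them are free. -/
structure Theory where
  Label : Type → Type*
  unitLabel : Label Unit
  tensorLabel : ∀ {ι κ : Type}, Label ι → Label κ → Label (ι × κ)
  Free : ∀ A B : Sys Label, (Matrix A.ι A.ι ℂ →ₗ[ℂ] Matrix B.ι B.ι ℂ) → Prop

namespace Theory

variable (T : Theory)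

/-- The trivial (one-dimensional) system. -/
def one : Sys T.Label := ⟨Unit, T.unitLabel⟩

variable {T}

/-- The composite system. -/
def tensor (A B : Sys T.Label) : Sys T.Label := ⟨A.ι × B.ι, T.tensorLabel A.label B.label⟩

/-- `n` copies of a system. -/
def pow (A : Sys T.Label) : ℕ → Sys T.Label
  | 0 => T.one
  | n + 1 => tensor (pow A n) A

/-- `ρ^{⊗n}`, a matrix on `n` copies of the system. -/
def powState {A : Sys T.Label} (ρ : Matrix A.ι A.ι ℂ) :
    (n : ℕ) → Matrix (pow A n).ι (pow A n).ι ℂ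
  | 0 => (1 : Matrix Unit Unit ℂ)
  | n + 1 => powState ρ n ⊗ₖ ρ

variable (T)

/-- The laws of a resource theory with tensor-product structure: free operations are channels,
contain the identities, are closed under composition and under acting on part of a composite
system, and moving subsystems around is free. -/
structure IsResourceTheory : Prop where
  channel : ∀ {A B : Sys T.Label} {Λ}, T.Free A B Λ → IsChannel Λ
  id : ∀ A : Sys T.Label, T.Free A A LinearMap.id
  comp : ∀ {A B C : Sys T.Label} {Λ Γ}, T.Free A B Λ → T.Free B C Γ → T.Free A C (Γ ∘ₗ Λ)
  tensor_id : ∀ {A B : Sys T.Label} {Λ} (C : Sys T.Label), T.Free A B Λ →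
    T.Free (tensor A C) (tensor B C) (tensorId C.ι Λ)
  assoc : ∀ A B C : Sys T.Label, T.Free (tensor (tensor A B) C) (tensor A (tensor B C))
    (relabel (Equiv.prodAssoc A.ι B.ι C.ι))
  assoc_symm : ∀ A B C : Sys T.Label, T.Free (tensor A (tensor B C)) (tensor (tensor A B) C)
    (relabel (Equiv.prodAssoc A.ι B.ι C.ι).symm)
  unitor : ∀ A : Sys T.Label, T.Free (tensor A T.one) A (relabel (Equiv.prodPUnit A.ι))
  unitor_symm : ∀ A : Sys T.Label, T.Free A (tensor A T.one)
    (relabel (Equiv.prodPUnit A.ι).symm)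
  swap : ∀ A B : Sys T.Label, T.Free (tensor A B) (tensor B A)
    (relabel (Equiv.prodComm A.ι B.ι))

/-- The free states of a system: those that a free operation prepares from nothing. -/
def freeStates (A : Sys T.Label) : Set (Matrix A.ι A.ι ℂ) :=
  {σ | ∃ Λ, T.Free T.one A Λ ∧ Λ (1 : Matrix Unit Unit ℂ) = σ}

variable {T}

/-- The rate `r` is achievable for the exact preparation of copies of `ρ` from copies of `Φ`. -/
def Achievable {Ω A : Sys T.Label} (Φ : Matrix Ω.ι Ω.ι ℂ) (ρ : Matrix A.ι A.ι ℂ) (r : ℝ) : Prop :=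
  ∀ δ : ℝ, 0 < δ → ∃ m n : ℕ, 0 < n ∧ (m : ℝ) / n ≤ r + δ ∧
    ∃ Λ, T.Free (pow Ω m) (pow A n) Λ ∧ Λ (powState Φ m) = powState ρ n

/-- The same with a catalyst `C`, whose state `τ` must be returned exactly, while correlations
between system and catalyst are allowed. -/
def CatAchievable {Ω A : Sys T.Label} (Φ : Matrix Ω.ι Ω.ι ℂ) (ρ : Matrix A.ι A.ι ℂ) (r : ℝ) :
    Prop :=
  ∀ δ : ℝ, 0 < δ → ∃ m n : ℕ, 0 < n ∧ (m : ℝ) / n ≤ r + δ ∧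
    ∃ (C : Sys T.Label) (τ : Matrix C.ι C.ι ℂ), IsState τ ∧
      ∃ Λ : Matrix ((pow Ω m).ι × C.ι) ((pow Ω m).ι × C.ι) ℂ →ₗ[ℂ]
          Matrix ((pow A n).ι × C.ι) ((pow A n).ι × C.ι) ℂ,
        T.Free (tensor (pow Ω m) C) (tensor (pow A n) C) Λ ∧
          trSnd (Λ (powState Φ m ⊗ₖ τ)) = powState ρ n ∧
          trFst (Λ (powState Φ m ⊗ₖ τ)) = τ

/-- The exact cost of `ρ` in units of `Φ`: the infimum of the achievable rates. -/
def cost {Ω A : Sys T.Label} (Φ : Matrix Ω.ι Ω.ι ℂ) (ρ : Matrix A.ι A.ι ℂ) : EReal :=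
  ⨅ (r : ℝ) (_ : Achievable Φ ρ r), (r : EReal)

/-- The catalytic exact cost of `ρ` in units of `Φ`. -/
def catCost {Ω A : Sys T.Label} (Φ : Matrix Ω.ι Ω.ι ℂ) (ρ : Matrix A.ι A.ι ℂ) : EReal :=
  ⨅ (r : ℝ) (_ : CatAchievable Φ ρ r), (r : EReal)

end Theory

/-! ### Thermodynamics at inverse temperature `β` -/

/-- The label of a system in thermodynamics: the energies of the basis states, the basis being
chosen as an eigenbasis of the Hamiltonian. -/
abbrev Energies (ι : Type) : Type := ι → ℝ

/-- The Gibbs state `exp(-βH) / tr exp(-βH)` for the Hamiltonian with energies `E`. -/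
def gibbs {ι : Type} [Fintype ι] [DecidableEq ι] (β : ℝ) (E : Energies ι) : Matrix ι ι ℂ :=
  Matrix.diagonal fun i => ((Real.exp (-β * E i) / ∑ j, Real.exp (-β * E j) : ℝ) : ℂ)

/-- The energies of two non-interacting systems. -/
def addEnergies {ι κ : Type} (E : Energies ι) (F : Energies κ) : Energies (ι × κ) :=
  fun x => E x.1 + F x.2

/-- The Hamiltonian as a matrix. -/
def hamiltonian {ι : Type} [DecidableEq ι] (E : Energies ι) : Matrix ι ι ℂ :=
  Matrix.diagonal fun i => (E i : ℂ)

/-- Thermal operations with a finite-dimensional bath: attach a bath `B` in its Gibbs state, apply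
an energy-conserving unitary `A ⊗ B → A' ⊗ B'`, discard `B'`. -/
def IsThermalOp (β : ℝ) (A A' : Sys Energies)
    (Λ : Matrix A.ι A.ι ℂ →ₗ[ℂ] Matrix A'.ι A'.ι ℂ) : Prop :=
  ∃ (B B' : Sys Energies) (U : Matrix (A'.ι × B'.ι) (A.ι × B.ι) ℂ),
    Uᴴ * U = 1 ∧ U * Uᴴ = 1 ∧
    U * hamiltonian (addEnergies A.label B.label)
      = hamiltonian (addEnergies A'.label B'.label) * U ∧
    ∀ X, Λ X = trSnd (U * (X ⊗ₖ gibbs β B.label) * Uᴴ)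

/-- The free operations of thermodynamics: thermal operations, with baths of unbounded size, that
is, the (sequential) closure of those with a finite-dimensional bath. -/
def IsThermal (β : ℝ) (A A' : Sys Energies)
    (Λ : Matrix A.ι A.ι ℂ →ₗ[ℂ] Matrix A'.ι A'.ι ℂ) : Prop :=
  ∃ Λs : ℕ → (Matrix A.ι A.ι ℂ →ₗ[ℂ] Matrix A'.ι A'.ι ℂ),
    (∀ k, IsThermalOp β A A' (Λs k)) ∧
    ∀ X, Filter.Tendsto (fun k => Λs k X) Filter.atTop (𝓝 (Λ X))

/-- The resource theory of thermodynamics at inverse temperature `β`. -/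
def thermo (β : ℝ) : Theory where
  Label := Energies
  unitLabel := fun _ => 0
  tensorLabel := addEnergies
  Free := IsThermal β

/-- The two-level system with energies `E 0` and `E 1`. -/
def qubit (β : ℝ) (E : Fin 2 → ℝ) : Sys (thermo β).Label := ⟨Fin 2, E⟩

/-- The pure state `|0⟩⟨0|`. -/
def ket0 : Matrix (Fin 2) (Fin 2) ℂ := Matrix.single 0 0 1

/-- The unit of work: a two-level system with vanishing Hamiltonian in a pure state, which is worth
one bit, that is `kT ln 2`, of work. -/
def workBit (β : ℝ) : Matrix (qubit β 0).ι (qubit β 0).ι ℂ := ket0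

/-- The exact work cost `W_c^0` of a state of the two-level system with energies `E`. -/
def workCost (β : ℝ) (E : Fin 2 → ℝ) (ρ : Matrix (Fin 2) (Fin 2) ℂ) : EReal :=
  Theory.cost (T := thermo β) (A := qubit β E) (workBit β) ρ

/-- The catalytic exact work cost `W_{c,c}^0`. -/
def catWorkCost (β : ℝ) (E : Fin 2 → ℝ) (ρ : Matrix (Fin 2) (Fin 2) ℂ) : EReal :=
  Theory.catCost (T := thermo β) (A := qubit β E) (workBit β) ρ

end QResource

end

open QResource

/-! Let `s = 2 ^ D_max(ρ‖S)`, attained at `σ`, so that `ρ ≤ sσ`; here `s > 1` because `ρ ∉ S`. If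
`½ρ + ½σ ≤ tω` with `ω ∈ S`, replacing `σ` by the smaller `ρ/s` gives `½(1 + 1/s)ρ ≤ tω`, and
optimality of `s` forces `t ≥ (s + 1)/2` (`exists_optimal`). By the strict inequality `(s + 1)/2 >
√s` the mixture costs more than `½ log s`, the average of the endpoint values.

Catalytically the mixture costs at most `½ log s`. The correlated state `½ρ⊗σ + ½σ⊗ρ` is at most `s
σ⊗σ`, so its cost is at most `log s`, and both of its marginals are the mixture. With `n` copies of
the mixture as catalyst, the first halves of `n` such pairs join the old catalyst to form `2n`
uncorrelated output copies, while the second halves become the new catalyst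
(`catAchievable_of_achievable`). Correlations between output and catalyst are what makes this
cheaper.

For the two-level system it remains to show that the work cost of diagonal states is `D_max` to the
Gibbs state (`cost_eq_Dmax`). Lower bound: thermal operations are positive and preserve Gibbs
states, and `m` pure work bits are at most `2 ^ m` times their Gibbs state; diagonal entries of
tensor powers then give the rate. Upper bound (`exists_isThermal_diagonal`): the bath is a copy of
the target system with a ladder whose level `l` is `⌊K x ^ l⌋`-fold degenerate, `x = e^{βε}`, so
that all levels have nearly equal total Gibbs weight. Inside each energy shell, basis states are
permuted so that the target populations appear up to rounding. The errors vanish as `K → ∞`, and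
compactness supplies a limit map. -/

noncomputable section

namespace QResource

/-! ### Max-relative entropy and failure of midpoint convexity -/

section Dmax

variable {ι : Type*}

lemma le_Dmax_of_forall {ρ σ : Matrix ι ι ℂ} {c : EReal}
    (h : ∀ s : ℝ, 0 < s → ((s : ℂ) • σ - ρ).PosSemidef → c ≤ (Real.logb 2 s : ℝ)) :
    c ≤ Dmax ρ σ :=
  le_iInf₂ fun s hs => h s hs.1 hs.2

lemma Dmax_le {ρ σ : Matrix ι ι ℂ} {s : ℝ} (hs : 0 < s) (h : ((s : ℂ) • σ - ρ).PosSemidef) :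
    Dmax ρ σ ≤ (Real.logb 2 s : ℝ) :=
  iInf₂_le s ⟨hs, h⟩

lemma DmaxSet_le {ρ σ : Matrix ι ι ℂ} {S : Set (Matrix ι ι ℂ)} (hσ : σ ∈ S) {s : ℝ} (hs : 0 < s)
    (h : ((s : ℂ) • σ - ρ).PosSemidef) : DmaxSet ρ S ≤ (Real.logb 2 s : ℝ) :=
  (iInf₂_le σ hσ).trans (Dmax_le hs h)

variable [Fintype ι]

lemma isClosed_posSemidef : IsClosed {M : Matrix ι ι ℂ | M.PosSemidef} := by
  simp only [Matrix.posSemidef_iff_dotProduct_mulVec, Set.ofPred_and, Set.ofPred_forall]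
  refine IsClosed.inter ?_ (isClosed_iInter fun x => ?_)
  · exact isClosed_eq continuous_id.matrix_conjTranspose continuous_id
  · exact isClosed_le continuous_const
      (continuous_const.dotProduct (continuous_id.matrix_mulVec continuous_const))

lemma IsState.one_le_of_le {ρ σ : Matrix ι ι ℂ} (hρ : IsState ρ) (hσ : IsState σ) {s : ℝ}
    (h : ((s : ℂ) • σ - ρ).PosSemidef) : 1 ≤ s := by
  have := h.trace_nonneg
  rw [Matrix.trace_sub, Matrix.trace_smul, hρ.2, hσ.2, smul_eq_mul, mul_one, sub_nonneg] at this
  exact_mod_cast this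

/-- The infimum is attained: the admissible `s` form a closed set, since the positive semidefinite
cone is closed, and comparing traces bounds it below by 1. Finiteness of `Dmax` makes it nonempty.
-/
lemma exists_Dmax_eq_logb {ρ σ : Matrix ι ι ℂ} (hρ : IsState ρ) (hσ : IsState σ)
    (h : Dmax ρ σ < ⊤) :
    ∃ s : ℝ, 1 ≤ s ∧ ((s : ℂ) • σ - ρ).PosSemidef ∧ Dmax ρ σ = (Real.logb 2 s : ℝ) := by
  set F : Set ℝ := {s | ((s : ℂ) • σ - ρ).PosSemidef} with hF
  have hone : ∀ s ∈ F, 1 ≤ s := fun s hs => hρ.one_le_of_le hσ hs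
  have hcl : IsClosed F :=
    isClosed_posSemidef.preimage
      (f := fun s : ℝ => (s : ℂ) • σ - ρ)
      ((Complex.continuous_ofReal.smul continuous_const).sub continuous_const)
  have hne : F.Nonempty := by
    by_contra hne
    rw [Set.not_nonempty_iff_eq_empty] at hne
    refine absurd h (not_lt.2 (le_Dmax_of_forall fun s _ hs => ?_))
    have : s ∈ F := hs
    rw [hne] at this
    exact this.elim
  have hbdd : BddBelow F := ⟨1, hone⟩
  have hmem := hcl.csInf_mem hne hbdd
  have h1 := hone _ hmem
  refine ⟨sInf F, h1, hmem, le_antisymm (Dmax_le (by linarith) hmem) ?_⟩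
  refine le_Dmax_of_forall fun s hs0 hs => ?_
  exact EReal.coe_le_coe_iff.2 (Real.logb_le_logb_of_le one_lt_two (by linarith) (csInf_le hbdd hs))

lemma DmaxSet_eq_zero_of_mem {S : Set (Matrix ι ι ℂ)} (hS : ∀ ω ∈ S, IsState ω)
    {σ : Matrix ι ι ℂ} (hσ : σ ∈ S) : DmaxSet σ S = 0 := by
  apply le_antisymm
  · have := DmaxSet_le (ρ := σ) hσ (s := 1) one_pos (by simpa using Matrix.PosSemidef.zero)
    simpa using this
  · refine le_iInf₂ fun ω hω => le_Dmax_of_forall fun s hs h => ?_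
    exact_mod_cast Real.logb_nonneg one_lt_two ((hS σ hσ).one_le_of_le (hS ω hω) h)

lemma eq_of_sub_posSemidef {ρ σ : Matrix ι ι ℂ} (hρ : IsState ρ) (hσ : IsState σ)
    (h : (σ - ρ).PosSemidef) : ρ = σ := by
  have : (σ - ρ).trace = 0 := by rw [Matrix.trace_sub, hρ.2, hσ.2, sub_self]
  exact (sub_eq_zero.1 (h.trace_eq_zero_iff.1 this)).symm

lemma IsState.mix {ρ σ : Matrix ι ι ℂ} (hρ : IsState ρ) (hσ : IsState σ) :
    IsState (mix ρ σ) := by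
  refine ⟨(hρ.1.smul (by positivity)).add (hσ.1.smul (by positivity)), ?_⟩
  rw [QResource.mix, Matrix.trace_add, Matrix.trace_smul, Matrix.trace_smul, hρ.2, hσ.2]
  norm_num

/-- Strict AM-GM: `((s + 1) / 2) ^ 2 - s = ((s - 1) / 2) ^ 2 > 0`. This gap yields both the
non-convexity and the catalytic advantage. -/
lemma half_logb_lt {s : ℝ} (hs : 1 < s) :
    1 / 2 * Real.logb 2 s < Real.logb 2 ((s + 1) / 2) := by
  have h : Real.logb 2 s < Real.logb 2 (((s + 1) / 2) ^ 2) :=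
    Real.logb_lt_logb one_lt_two (by linarith) (by nlinarith [sq_pos_of_pos (sub_pos.2 hs)])
  rw [Real.logb_pow] at h
  push_cast at h
  linarith

/-- The optimal value `s = 2 ^ D_max(ρ‖S)`, and the bound it gives for the equal mixture with the
optimiser. -/
lemma exists_optimal {S : Set (Matrix ι ι ℂ)} {ρ σ : Matrix ι ι ℂ}
    (hS : ∀ ω ∈ S, IsState ω) (hρ : IsState ρ) (hρS : ρ ∉ S) (hσ : σ ∈ S)
    (hopt : Dmax ρ σ = DmaxSet ρ S) (hfin : DmaxSet ρ S < ⊤) :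
    ∃ s : ℝ, 1 < s ∧ ((s : ℂ) • σ - ρ).PosSemidef ∧ DmaxSet ρ S = (Real.logb 2 s : ℝ) ∧
      ((Real.logb 2 ((s + 1) / 2) : ℝ) : EReal) ≤ DmaxSet (mix ρ σ) S := by
  obtain ⟨s, hs1, hpsd, hD⟩ := exists_Dmax_eq_logb hρ (hS σ hσ) (hopt ▸ hfin)
  have hs : 1 < s := by
    refine lt_of_le_of_ne hs1 fun h => hρS ?_
    rw [← h, Complex.ofReal_one, one_smul] at hpsd
    exact eq_of_sub_posSemidef hρ (hS σ hσ) hpsd ▸ hσ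
  rw [hopt] at hD
  refine ⟨s, hs, hpsd, hD, le_iInf₂ fun ω hω => le_Dmax_of_forall fun t ht h => ?_⟩
  have hs0 : (0 : ℝ) < s := by linarith
  have hsc : (s : ℂ) ≠ 0 := by exact_mod_cast hs0.ne'
  have hs1c : (s : ℂ) + 1 ≠ 0 := by exact_mod_cast (by linarith : s + 1 ≠ 0)
  -- The weights `2s/(s+1)` and `1/(s+1)` are chosen so that `σ` cancels and `ρ` gets coefficient
  -- `-1`.
  have key : (((2 * t * s / (s + 1) : ℝ) : ℂ) • ω - ρ).PosSemidef := by
    have h1 := (h.smul (a := ((2 * s / (s + 1) : ℝ) : ℂ)) (by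
      rw [Complex.zero_le_real]; positivity)).add
      (hpsd.smul (a := ((1 / (s + 1) : ℝ) : ℂ)) (by
        rw [Complex.zero_le_real]; positivity))
    convert h1 using 1
    ext i j
    simp only [mix, Matrix.sub_apply, Matrix.add_apply, Matrix.smul_apply, smul_eq_mul]
    push_cast
    field_simp
    ring
  -- Optimality of `s` now reads `s ≤ 2ts/(s+1)`, that is `t ≥ (s+1)/2`.
  have hle := DmaxSet_le hω (by positivity) key
  rw [hD, EReal.coe_le_coe_iff, Real.logb_le_logb one_lt_two hs0 (by positivity),
    le_div_iff₀ (by positivity)] at hle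
  refine EReal.coe_le_coe_iff.2 (Real.logb_le_logb_of_le one_lt_two (by positivity) ?_)
  have : s * (s + 1) ≤ s * (2 * t) := by linarith
  linarith [le_of_mul_le_mul_left this hs0]

/-- `D_max(·‖S)` is not midpoint-convex on the segment from a non-free state to its optimiser. -/
theorem half_DmaxSet_lt {S : Set (Matrix ι ι ℂ)} {ρ σ : Matrix ι ι ℂ}
    (hS : ∀ ω ∈ S, IsState ω) (hρ : IsState ρ) (hρS : ρ ∉ S) (hσ : σ ∈ S)
    (hopt : Dmax ρ σ = DmaxSet ρ S) (hfin : DmaxSet ρ S < ⊤) :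
    ((1 / 2 : ℝ) : EReal) * DmaxSet ρ S + ((1 / 2 : ℝ) : EReal) * DmaxSet σ S
      < DmaxSet (mix ρ σ) S := by
  obtain ⟨s, hs, -, hD, hle⟩ := exists_optimal hS hρ hρS hσ hopt hfin
  rw [DmaxSet_eq_zero_of_mem hS hσ, hD, mul_zero, add_zero, ← EReal.coe_mul]
  exact lt_of_lt_of_le (EReal.coe_lt_coe_iff.2 (half_logb_lt hs)) hle

end Dmax

/-! ### Partial traces, regrouping of factors and the symmetrised product -/

section PartialTrace

variable {ι κ μ ν : Type*}

lemma relabel_apply (e : ι ≃ κ) (X : Matrix ι ι ℂ) (i j : κ) :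
    relabel e X i j = X (e.symm i) (e.symm j) := rfl

lemma tensorId_kronecker (Λ : Matrix ι ι ℂ →ₗ[ℂ] Matrix κ κ ℂ) (X : Matrix ι ι ℂ)
    (Y : Matrix μ μ ℂ) : tensorId μ Λ (X ⊗ₖ Y) = Λ X ⊗ₖ Y := by
  ext a b
  have : (Matrix.of fun i j => (X ⊗ₖ Y) (i, a.2) (j, b.2)) = Y a.2 b.2 • X := by
    ext i j
    simp [Matrix.kroneckerMap_apply, mul_comm]
  change Λ (Matrix.of fun i j => (X ⊗ₖ Y) (i, a.2) (j, b.2)) a.1 b.1 = _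
  rw [this, map_smul]
  simp [Matrix.kroneckerMap_apply, mul_comm]

lemma trace_trSnd [Fintype ι] [Fintype κ] (X : Matrix (ι × κ) (ι × κ) ℂ) :
    (trSnd X).trace = X.trace := by
  simp [trSnd, Matrix.trace, Fintype.sum_prod_type]

lemma trSnd_kronecker [Fintype κ] (X : Matrix ι ι ℂ) (Y : Matrix κ κ ℂ) :
    trSnd (X ⊗ₖ Y) = Y.trace • X := by
  ext i j
  simp [trSnd, Matrix.kroneckerMap_apply, Matrix.trace, ← Finset.mul_sum, mul_comm]

lemma trFst_kronecker [Fintype ι] (X : Matrix ι ι ℂ) (Y : Matrix κ κ ℂ) :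
    trFst (X ⊗ₖ Y) = X.trace • Y := by
  ext i j
  simp [trFst, Matrix.kroneckerMap_apply, Matrix.trace, ← Finset.sum_mul]

/-- The bijection exchanging the two middle factors. -/
def midSwap (ι κ μ ν : Type*) : (ι × κ) × (μ × ν) ≃ (ι × μ) × (κ × ν) where
  toFun x := ((x.1.1, x.2.1), (x.1.2, x.2.2))
  invFun x := ((x.1.1, x.2.1), (x.1.2, x.2.2))
  left_inv _ := rfl
  right_inv _ := rfl

lemma trSnd_midSwap [Fintype κ] [Fintype ν] (X : Matrix (ι × κ) (ι × κ) ℂ)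
    (Y : Matrix (μ × ν) (μ × ν) ℂ) :
    trSnd (relabel (midSwap ι κ μ ν) (X ⊗ₖ Y)) = trSnd X ⊗ₖ trSnd Y := by
  ext i j
  simp [trSnd, relabel_apply, Matrix.kroneckerMap_apply, Fintype.sum_prod_type, midSwap,
    Finset.sum_mul_sum]

lemma trFst_midSwap [Fintype ι] [Fintype μ] (X : Matrix (ι × κ) (ι × κ) ℂ)
    (Y : Matrix (μ × ν) (μ × ν) ℂ) :
    trFst (relabel (midSwap ι κ μ ν) (X ⊗ₖ Y)) = trFst X ⊗ₖ trFst Y := by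
  ext i j
  simp [trFst, relabel_apply, Matrix.kroneckerMap_apply, Fintype.sum_prod_type, midSwap,
    Finset.sum_mul_sum]

/-- The bijection moving the third factor in front of the second. -/
def rightSwap (ι κ μ : Type*) : (ι × κ) × μ ≃ (ι × μ) × κ where
  toFun x := ((x.1.1, x.2), x.1.2)
  invFun x := ((x.1.1, x.2), x.1.2)
  left_inv _ := rfl
  right_inv _ := rfl

/-- In the catalytic protocol `X` is a fresh pair and `Y` the old catalyst. As `Y` is uncorrelated
with `X`, it forms a product with the retained half of `X`. -/
lemma trSnd_rightSwap [Fintype κ] (X : Matrix (ι × κ) (ι × κ) ℂ) (Y : Matrix μ μ ℂ) :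
    trSnd (relabel (rightSwap ι κ μ) (X ⊗ₖ Y)) = trSnd X ⊗ₖ Y := by
  ext i j
  simp [trSnd, relabel_apply, Matrix.kroneckerMap_apply, rightSwap, Finset.sum_mul]

lemma trFst_rightSwap [Fintype ι] [Fintype μ] (X : Matrix (ι × κ) (ι × κ) ℂ)
    (Y : Matrix μ μ ℂ) :
    trFst (relabel (rightSwap ι κ μ) (X ⊗ₖ Y)) = Y.trace • trFst X := by
  ext i j
  simp [trFst, relabel_apply, Matrix.kroneckerMap_apply, rightSwap, Fintype.sum_prod_type,
    Matrix.trace, ← Finset.sum_mul, mul_comm]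

lemma trSnd_tensorId_relabel [Fintype κ] (e : ι ≃ μ) (X : Matrix (ι × κ) (ι × κ) ℂ) :
    trSnd (tensorId κ (relabel e) X) = relabel e (trSnd X) := rfl

lemma trFst_tensorId_relabel [Fintype ι] [Fintype μ] (e : ι ≃ μ)
    (X : Matrix (ι × κ) (ι × κ) ℂ) :
    trFst (tensorId κ (relabel e) X) = trFst X := by
  ext i j
  exact Equiv.sum_comp e.symm fun k => X (k, i) (k, j)

/-- The symmetrised product `½ ρ ⊗ σ + ½ σ ⊗ ρ`. -/
def symProd (ρ σ : Matrix ι ι ℂ) : Matrix (ι × ι) (ι × ι) ℂ :=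
  mix (ρ ⊗ₖ σ) (σ ⊗ₖ ρ)

lemma trSnd_mix [Fintype κ] (X Y : Matrix (ι × κ) (ι × κ) ℂ) :
    trSnd (mix X Y) = mix (trSnd X) (trSnd Y) := by
  ext i j
  simp [trSnd, mix, Finset.sum_add_distrib, Finset.mul_sum]

lemma trFst_mix [Fintype ι] (X Y : Matrix (ι × κ) (ι × κ) ℂ) :
    trFst (mix X Y) = mix (trFst X) (trFst Y) := by
  ext i j
  simp [trFst, mix, Finset.sum_add_distrib, Finset.mul_sum]

lemma mix_comm (ρ σ : Matrix ι ι ℂ) : mix ρ σ = mix σ ρ := add_comm _ _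

lemma trSnd_symProd [Fintype ι] {ρ σ : Matrix ι ι ℂ} (hρ : IsState ρ) (hσ : IsState σ) :
    trSnd (symProd ρ σ) = mix ρ σ := by
  rw [symProd, trSnd_mix, trSnd_kronecker, trSnd_kronecker, hρ.2, hσ.2, one_smul, one_smul]

lemma trFst_symProd [Fintype ι] {ρ σ : Matrix ι ι ℂ} (hρ : IsState ρ) (hσ : IsState σ) :
    trFst (symProd ρ σ) = mix ρ σ := by
  rw [symProd, trFst_mix, trFst_kronecker, trFst_kronecker, hρ.2, hσ.2, one_smul, one_smul,
    mix_comm]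

lemma IsState.kronecker [Fintype ι] [Fintype κ] {ρ : Matrix ι ι ℂ} {σ : Matrix κ κ ℂ}
    (hρ : IsState ρ) (hσ : IsState σ) : IsState (ρ ⊗ₖ σ) :=
  ⟨hρ.1.kronecker hσ.1, by rw [Matrix.trace_kronecker, hρ.2, hσ.2, one_mul]⟩

lemma IsState.symProd [Fintype ι] {ρ σ : Matrix ι ι ℂ} (hρ : IsState ρ) (hσ : IsState σ) :
    IsState (symProd ρ σ) :=
  (hρ.kronecker hσ).mix (hσ.kronecker hρ)

/-- If `ρ ≤ s σ`, then `½ ρ ⊗ σ + ½ σ ⊗ ρ ≤ s σ ⊗ σ`. -/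
lemma symProd_le [Fintype ι] {ρ σ : Matrix ι ι ℂ} (hσ : σ.PosSemidef) {s : ℝ}
    (h : ((s : ℂ) • σ - ρ).PosSemidef) :
    ((s : ℂ) • (σ ⊗ₖ σ) - QResource.symProd ρ σ).PosSemidef := by
  -- Both `ρ ⊗ σ` and `σ ⊗ ρ` lie below `s σ ⊗ σ`, each with the same constant `s`; only one factor
  -- is non-free at a time.
  have heq : (s : ℂ) • (σ ⊗ₖ σ) - QResource.symProd ρ σ
      = (1 / 2 : ℂ) • (((s : ℂ) • σ - ρ) ⊗ₖ σ) + (1 / 2 : ℂ) • (σ ⊗ₖ ((s : ℂ) • σ - ρ)) := by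
    ext i j
    simp only [QResource.symProd, mix, Matrix.sub_apply, Matrix.add_apply, Matrix.smul_apply,
      smul_eq_mul, Matrix.kroneckerMap_apply]
    ring
  rw [heq]
  exact ((h.kronecker hσ).smul (by positivity)).add ((hσ.kronecker h).smul (by positivity))

end PartialTrace

/-! ### Catalysis from rearrangements of subsystems -/

namespace Theory

variable {T : Theory}

lemma isState_powState {A : Sys T.Label} {ρ : Matrix A.ι A.ι ℂ} (hρ : IsState ρ) :
    ∀ n, IsState (powState ρ n)
  | 0 => ⟨Matrix.PosSemidef.one, by
      change Matrix.trace (1 : Matrix Unit Unit ℂ) = 1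
      simp⟩
  | n + 1 => (isState_powState hρ n).kronecker hρ

/-- The part of the laws of a resource theory that concerns composition and rearrangement. -/
structure HasRearrangements (T : Theory) : Prop where
  comp : ∀ {A B C : Sys T.Label} {Λ Γ}, T.Free A B Λ → T.Free B C Γ → T.Free A C (Γ ∘ₗ Λ)
  tensor_id : ∀ {A B : Sys T.Label} {Λ} (C : Sys T.Label), T.Free A B Λ →
    T.Free (tensor A C) (tensor B C) (tensorId C.ι Λ)
  assoc : ∀ A B C : Sys T.Label, T.Free (tensor (tensor A B) C) (tensor A (tensor B C))
    (relabel (Equiv.prodAssoc A.ι B.ι C.ι))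
  assoc_symm : ∀ A B C : Sys T.Label, T.Free (tensor A (tensor B C)) (tensor (tensor A B) C)
    (relabel (Equiv.prodAssoc A.ι B.ι C.ι).symm)
  unitor : ∀ A : Sys T.Label, T.Free (tensor A T.one) A (relabel (Equiv.prodPUnit A.ι))
  unitor_symm : ∀ A : Sys T.Label, T.Free A (tensor A T.one)
    (relabel (Equiv.prodPUnit A.ι).symm)
  swap : ∀ A B : Sys T.Label, T.Free (tensor A B) (tensor B A)
    (relabel (Equiv.prodComm A.ι B.ι))

lemma IsResourceTheory.hasRearrangements (hT : T.IsResourceTheory) : T.HasRearrangements :=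
  ⟨hT.comp, hT.tensor_id, hT.assoc, hT.assoc_symm, hT.unitor, hT.unitor_symm, hT.swap⟩

namespace HasRearrangements

variable (hT : T.HasRearrangements)

include hT

lemma rightSwap (A B C : Sys T.Label) :
    T.Free (tensor (tensor A B) C) (tensor (tensor A C) B)
      (relabel (QResource.rightSwap A.ι B.ι C.ι)) := by
  -- The laws let operations act on the left factor only, so `B ⊗ C` is moved to the left, swapped
  -- there and moved back.
  have h1 := hT.assoc A B C
  have h2 := hT.swap A (tensor B C)
  have h3 := hT.tensor_id A (hT.swap B C)
  have h4 := hT.swap (tensor C B) A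
  exact hT.comp (hT.comp (hT.comp h1 h2) (hT.comp h3 h4)) (hT.assoc_symm A C B)

lemma midSwap (A B C D : Sys T.Label) :
    T.Free (tensor (tensor A B) (tensor C D)) (tensor (tensor A C) (tensor B D))
      (relabel (QResource.midSwap A.ι B.ι C.ι D.ι)) := by
  have h1 := hT.assoc_symm (tensor A B) C D
  have h2 := hT.tensor_id D (hT.rightSwap A B C)
  exact hT.comp (hT.comp h1 h2) (hT.assoc (tensor A C) B D)

/-- Concatenation `A^{⊗n} ⊗ A^{⊗k} → A^{⊗(n+k)}` is free. -/
lemma exists_append {A : Sys T.Label} (n k : ℕ) :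
    ∃ e : (pow A n).ι × (pow A k).ι ≃ (pow A (n + k)).ι,
      T.Free (tensor (pow A n) (pow A k)) (pow A (n + k)) (relabel e) ∧
      ∀ ρ : Matrix A.ι A.ι ℂ, relabel e (powState ρ n ⊗ₖ powState ρ k) = powState ρ (n + k) := by
  induction k with
  | zero =>
    refine ⟨Equiv.prodPUnit (pow A n).ι, hT.unitor _, fun ρ => ?_⟩
    ext i j
    change powState ρ n i j * (1 : Matrix Unit Unit ℂ) () () = _
    simp
  | succ k ih =>
    obtain ⟨e, he, hρ⟩ := ih
    refine ⟨(Equiv.prodAssoc _ _ _).symm.trans (e.prodCongr (Equiv.refl A.ι)),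
      hT.comp (hT.assoc_symm (pow A n) (pow A k) A) (hT.tensor_id A he), fun ρ => ?_⟩
    ext i j
    have := congrFun (congrFun (hρ ρ) i.1) j.1
    change powState ρ n _ _ * (powState ρ k _ _ * ρ _ _) = powState ρ (n + k) _ _ * ρ _ _
    rw [← this, ← mul_assoc]
    rfl

/-- Separating the two halves, `(A ⊗ A)^{⊗n} → A^{⊗n} ⊗ A^{⊗n}`, is free. -/
lemma exists_unzip {A : Sys T.Label} {ω : Matrix (tensor A A).ι (tensor A A).ι ℂ}
    {ρ : Matrix A.ι A.ι ℂ} (h₁ : trSnd (ι := A.ι) (κ := A.ι) ω = ρ)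
    (h₂ : trFst (ι := A.ι) (κ := A.ι) ω = ρ) (n : ℕ) :
    ∃ e : (pow (tensor A A) n).ι ≃ (pow A n).ι × (pow A n).ι,
      T.Free (pow (tensor A A) n) (tensor (pow A n) (pow A n)) (relabel e) ∧
      trSnd (relabel e (powState ω n)) = powState ρ n ∧
      trFst (relabel e (powState ω n)) = powState ρ n := by
  induction n with
  | zero =>
    refine ⟨(Equiv.prodPUnit Unit).symm, hT.unitor_symm _, ?_, ?_⟩ <;>
    · ext i j
      change ∑ _ : Unit, (1 : Matrix Unit Unit ℂ) () () = (1 : Matrix Unit Unit ℂ) () ()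
      simp
  | succ n ih =>
    obtain ⟨e, he, hS, hF⟩ := ih
    refine ⟨(e.prodCongr (Equiv.refl _)).trans (QResource.midSwap _ _ _ _),
      hT.comp (hT.tensor_id (tensor A A) he) (hT.midSwap (pow A n) (pow A n) A A), ?_, ?_⟩
    · have := trSnd_midSwap (relabel e (powState ω n)) (ι := (pow A n).ι) (κ := (pow A n).ι)
        (μ := A.ι) (ν := A.ι) ω
      rw [hS, h₁] at this
      exact this
    · have := trFst_midSwap (relabel e (powState ω n)) (ι := (pow A n).ι) (κ := (pow A n).ι)
        (μ := A.ι) (ν := A.ι) ω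
      rw [hF, h₂] at this
      exact this

/-- If `ω` on `A ⊗ A` has both marginals equal to `ρ`, then one copy of `ω` catalytically yields
two copies of `ρ`. -/
theorem catAchievable_of_achievable {Ω A : Sys T.Label} {Φ : Matrix Ω.ι Ω.ι ℂ}
    {ω : Matrix (tensor A A).ι (tensor A A).ι ℂ} {ρ : Matrix A.ι A.ι ℂ} (hρ : IsState ρ)
    (h₁ : trSnd (ι := A.ι) (κ := A.ι) ω = ρ) (h₂ : trFst (ι := A.ι) (κ := A.ι) ω = ρ) {r : ℝ}
    (hω : Achievable Φ ω r) : CatAchievable Φ ρ (r / 2) := by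
  intro δ hδ
  obtain ⟨m, n, hn, hmn, Λ, hΛ, hΛω⟩ := hω δ hδ
  obtain ⟨e, he, heS, heF⟩ := hT.exists_unzip h₁ h₂ n
  obtain ⟨f, hf, hfρ⟩ := hT.exists_append (A := A) n n
  -- The catalyst is `ρ^{⊗n}`. The first halves of `ω^{⊗n}` and the old catalyst are output, the
  -- second halves become the new catalyst; `m` units thus buy `2n` copies.
  refine ⟨m, n + n, by omega, ?_, pow A n, powState ρ n, isState_powState hρ n, _,
    hT.comp (hT.comp (hT.tensor_id (pow A n) (hT.comp hΛ he))
      (hT.rightSwap (pow A n) (pow A n) (pow A n))) (hT.tensor_id (pow A n) hf), ?_⟩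
  · have hn' : (0 : ℝ) < n := by exact_mod_cast hn
    push_cast
    have : (m : ℝ) / (n + n) = (m / n) / 2 := by field_simp; ring
    rw [this]
    linarith
  · have key : (tensorId (pow A n).ι (relabel e ∘ₗ Λ)) (powState Φ m ⊗ₖ powState ρ n)
        = relabel e (powState ω n) ⊗ₖ powState ρ n := by
      rw [tensorId_kronecker, LinearMap.comp_apply, hΛω]
    constructor
    · have : trSnd (tensorId (pow A n).ι (relabel f)
          (relabel (QResource.rightSwap (pow A n).ι (pow A n).ι (pow A n).ι)
            (relabel e (powState ω n) ⊗ₖ powState ρ n))) = powState ρ (n + n) := by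
        rw [trSnd_tensorId_relabel, trSnd_rightSwap, heS, hfρ]
      rw [← key] at this
      exact this
    · have : trFst (tensorId (pow A n).ι (relabel f)
          (relabel (QResource.rightSwap (pow A n).ι (pow A n).ι (pow A n).ι)
            (relabel e (powState ω n) ⊗ₖ powState ρ n))) = powState ρ n := by
        rw [trFst_tensorId_relabel, trFst_rightSwap, heF, (isState_powState hρ n).2, one_smul]
      rw [← key] at this
      exact this

end HasRearrangements

lemma IsResourceTheory.isState_of_mem_freeStates (hT : T.IsResourceTheory) {A : Sys T.Label}
    {σ : Matrix A.ι A.ι ℂ} (hσ : σ ∈ T.freeStates A) : IsState σ := by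
  obtain ⟨Λ, hΛ, rfl⟩ := hσ
  obtain ⟨r, K, hK, hΛ⟩ := hT.channel hΛ
  have h1 : Λ (1 : Matrix Unit Unit ℂ) = ∑ i, K i * (K i)ᴴ := by
    refine (hΛ _).trans (Finset.sum_congr rfl fun i _ => ?_)
    congr 1
    exact Matrix.mul_one (K i)
  rw [h1]
  refine ⟨Matrix.posSemidef_sum _ fun i _ => Matrix.posSemidef_self_mul_conjTranspose (K i), ?_⟩
  rw [Matrix.trace_sum, Finset.sum_congr rfl fun i _ => Matrix.trace_mul_comm (K i) (K i)ᴴ,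
    ← Matrix.trace_sum, hK]
  change Matrix.trace (1 : Matrix Unit Unit ℂ) = 1
  simp

/-- Prepare the first state, adjoin a trivial system, and prepare the second state from it. -/
lemma IsResourceTheory.kronecker_mem_freeStates (hT : T.IsResourceTheory) {A B : Sys T.Label}
    {σ : Matrix A.ι A.ι ℂ} {τ : Matrix B.ι B.ι ℂ} (hσ : σ ∈ T.freeStates A)
    (hτ : τ ∈ T.freeStates B) :
    Matrix.kroneckerMap (· * ·) σ τ ∈ T.freeStates (tensor A B) := by
  obtain ⟨Λ, hΛ, rfl⟩ := hσ
  obtain ⟨Γ, hΓ, rfl⟩ := hτ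
  refine ⟨_, hT.comp (hT.comp (hT.comp hΛ (hT.unitor_symm A))
    (hT.swap A T.one)) (hT.comp (hT.tensor_id A hΓ) (hT.swap B A)), ?_⟩
  have h1 : (relabel (Equiv.prodComm A.ι Unit)) (relabel (Equiv.prodPUnit A.ι).symm
      (Λ (1 : Matrix Unit Unit ℂ))) = (1 : Matrix Unit Unit ℂ) ⊗ₖ Λ (1 : Matrix Unit Unit ℂ) := by
    ext i j
    simp [relabel_apply, Matrix.kroneckerMap_apply]
  change relabel (Equiv.prodComm B.ι A.ι) (tensorId A.ι Γ (relabel (Equiv.prodComm A.ι Unit)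
    (relabel (Equiv.prodPUnit A.ι).symm (Λ (1 : Matrix Unit Unit ℂ))))) = _
  rw [h1]
  have h2 := tensorId_kronecker Γ (1 : Matrix Unit Unit ℂ) (Λ (1 : Matrix Unit Unit ℂ))
  refine (congrArg (relabel (Equiv.prodComm B.ι A.ι)) h2).trans ?_
  ext i j
  exact mul_comm _ _

lemma catCost_le {Ω A : Sys T.Label} {Φ : Matrix Ω.ι Ω.ι ℂ} {ρ : Matrix A.ι A.ι ℂ} {r : ℝ}
    (h : CatAchievable Φ ρ r) : catCost Φ ρ ≤ r :=
  iInf₂_le r h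

lemma exists_achievable_of_cost_lt {Ω A : Sys T.Label} {Φ : Matrix Ω.ι Ω.ι ℂ}
    {ρ : Matrix A.ι A.ι ℂ} {c : EReal} (h : cost Φ ρ < c) :
    ∃ r : ℝ, Achievable Φ ρ r ∧ (r : EReal) < c := by
  simpa only [cost, iInf_lt_iff, exists_prop] using h

end Theory

/-! ### Non-convexity and catalytic advantage in a general theory -/

open Theory in
/-- Non-convexity of the exact cost and catalytic advantage in an arbitrary resource theory in
which the exact cost is `D_max(·‖S)` on a class `𝒞` of states. -/
theorem cost_mix_and_catCost_mix {T : Theory} (hT : T.IsResourceTheory)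
    {Ω : Sys T.Label} {Φ : Matrix Ω.ι Ω.ι ℂ}
    {𝒞 : ∀ A : Sys T.Label, Set (Matrix A.ι A.ι ℂ)}
    (htensor : ∀ (A B : Sys T.Label) (ρ : Matrix A.ι A.ι ℂ) (σ : Matrix B.ι B.ι ℂ),
      ρ ∈ 𝒞 A → σ ∈ 𝒞 B → Matrix.kroneckerMap (· * ·) ρ σ ∈ 𝒞 (tensor A B))
    (hmix : ∀ (A : Sys T.Label) (ρ σ : Matrix A.ι A.ι ℂ), ρ ∈ 𝒞 A → σ ∈ 𝒞 A → mix ρ σ ∈ 𝒞 A)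
    (hcost : ∀ (A : Sys T.Label) (ρ : Matrix A.ι A.ι ℂ), IsState ρ → ρ ∈ 𝒞 A →
      cost Φ ρ = DmaxSet ρ (T.freeStates A))
    {A : Sys T.Label} {ρ σ : Matrix A.ι A.ι ℂ} (hρ : IsState ρ) (hρ𝒞 : ρ ∈ 𝒞 A)
    (hρS : ρ ∉ T.freeStates A) (hσ𝒞 : σ ∈ 𝒞 A) (hσ : σ ∈ T.freeStates A)
    (hopt : Dmax ρ σ = DmaxSet ρ (T.freeStates A)) (hfin : DmaxSet ρ (T.freeStates A) < ⊤) :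
    ((1 / 2 : ℝ) : EReal) * cost Φ ρ + ((1 / 2 : ℝ) : EReal) * cost Φ σ < cost Φ (mix ρ σ) ∧
      catCost Φ (mix ρ σ) < cost Φ (mix ρ σ) := by
  have hS : ∀ ω ∈ T.freeStates A, IsState ω := fun ω hω => hT.isState_of_mem_freeStates hω
  have hσs := hS σ hσ
  rw [hcost A ρ hρ hρ𝒞, hcost A σ hσs hσ𝒞, hcost A _ (hρ.mix hσs) (hmix A ρ σ hρ𝒞 hσ𝒞)]
  refine ⟨half_DmaxSet_lt hS hρ hρS hσ hopt hfin, ?_⟩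
  obtain ⟨s, hs, hpsd, -, hle⟩ := exists_optimal hS hρ hρS hσ hopt hfin
  -- A state on two copies with both marginals equal to the mixture. It is dominated by `s σ ⊗ σ`,
  -- so its cost is at most `log s`, strictly below twice the lower bound for the mixture.
  let ω : Matrix (tensor A A).ι (tensor A A).ι ℂ := symProd ρ σ
  have hωc : cost Φ ω < ((2 * Real.logb 2 ((s + 1) / 2) : ℝ) : EReal) := by
    rw [hcost (tensor A A) ω (hρ.symProd hσs)
      (hmix _ _ _ (htensor _ _ _ _ hρ𝒞 hσ𝒞) (htensor _ _ _ _ hσ𝒞 hρ𝒞))]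
    refine lt_of_le_of_lt (DmaxSet_le (hT.kronecker_mem_freeStates hσ hσ) (by linarith)
      (symProd_le hσs.1 hpsd)) (EReal.coe_lt_coe_iff.2 ?_)
    linarith [half_logb_lt hs]
  obtain ⟨r, hr, hrlt⟩ := exists_achievable_of_cost_lt hωc
  have hcat := hT.hasRearrangements.catAchievable_of_achievable (hρ.mix hσs)
    (trSnd_symProd hρ hσs) (trFst_symProd hρ hσs) hr
  refine lt_of_lt_of_le (lt_of_le_of_lt (catCost_le hcat) (EReal.coe_lt_coe_iff.2 ?_)) hle
  have := EReal.coe_lt_coe_iff.1 hrlt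
  linarith

/-! ### Block calculus for dilations -/

section Blocks

variable {ι κ μ ν : Type*}

/-- The block of a matrix on `ι × κ` at a pair of elements of `κ`. -/
def block (Z : Matrix (ι × κ) (ι × κ) ℂ) (c c' : κ) : Matrix ι ι ℂ :=
  Matrix.of fun i j => Z (i, c) (j, c')

lemma trSnd_eq_sum_block [Fintype κ] (Z : Matrix (ι × κ) (ι × κ) ℂ) :
    trSnd Z = ∑ c, block Z c c := by
  ext i j
  simp [trSnd, block, Matrix.sum_apply]

lemma block_conj_kronecker_one [Fintype ι] [Fintype κ] [DecidableEq κ] (U : Matrix μ ι ℂ)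
    (Z : Matrix (ι × κ) (ι × κ) ℂ) (c c' : κ) :
    block ((U ⊗ₖ (1 : Matrix κ κ ℂ)) * Z * (U ⊗ₖ (1 : Matrix κ κ ℂ))ᴴ) c c'
      = U * block Z c c' * Uᴴ := by
  ext i j
  simp only [block, Matrix.of_apply, Matrix.mul_apply, Matrix.kroneckerMap_apply,
    Fintype.sum_prod_type, Matrix.conjTranspose_apply, Matrix.one_apply, mul_ite, mul_one,
    mul_zero, ite_mul, zero_mul, apply_ite star, star_zero,
    Finset.sum_ite_eq, Finset.mem_univ, if_true]

lemma trSnd_conj_kronecker_one [Fintype ι] [Fintype κ] [DecidableEq κ] (U : Matrix μ ι ℂ)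
    (Z : Matrix (ι × κ) (ι × κ) ℂ) :
    trSnd ((U ⊗ₖ (1 : Matrix κ κ ℂ)) * Z * (U ⊗ₖ (1 : Matrix κ κ ℂ))ᴴ)
      = U * trSnd Z * Uᴴ := by
  simp only [trSnd_eq_sum_block, block_conj_kronecker_one, Matrix.mul_sum, Matrix.sum_mul]

lemma conj_submatrix [Fintype ι] [Fintype κ] (M : Matrix μ κ ℂ) (e : ν ≃ μ) (f : ι ≃ κ)
    (X : Matrix ι ι ℂ) :
    M.submatrix e f * X * (M.submatrix e f)ᴴ = relabel e.symm (M * relabel f X * Mᴴ) := by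
  have hX : X = (relabel f X).submatrix f f := by
    ext i j
    simp [relabel_apply]
  conv_lhs => rw [hX]
  rw [Matrix.conjTranspose_submatrix, Matrix.submatrix_mul_equiv, Matrix.submatrix_mul_equiv]
  rfl

lemma posSemidef_trSnd [Fintype ι] [Fintype κ] {X : Matrix (ι × κ) (ι × κ) ℂ}
    (hX : X.PosSemidef) : (trSnd X).PosSemidef := by
  rw [trSnd_eq_sum_block]
  exact Matrix.posSemidef_sum _ fun c _ => hX.submatrix fun i => (i, c)

/-- The bijection `(ι × κ) × μ ≃ ι × (μ × κ)`. -/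
def assocSwap (ι κ μ : Type*) : ι × (μ × κ) ≃ (ι × κ) × μ where
  toFun x := ((x.1, x.2.2), x.2.1)
  invFun x := (x.1.1, (x.2, x.1.2))
  left_inv _ := rfl
  right_inv _ := rfl

lemma trSnd_assocSwap [Fintype κ] [Fintype μ] (Z : Matrix ((ι × κ) × μ) ((ι × κ) × μ) ℂ) :
    trSnd (relabel (assocSwap ι κ μ).symm Z) = trSnd (trSnd Z) := by
  ext i j
  simp only [trSnd, relabel_apply, Matrix.of_apply, Fintype.sum_prod_type, assocSwap]
  exact Finset.sum_comm

/-- The discarded system `κ'` of the first dilation is a spectator of the second, so tracing it out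
commutes with conjugation by `V`. This makes thermal operations composable with a joint bath. -/
lemma conj_dilation_mul [Fintype ι] [Fintype κ] [Fintype μ] {κ' ν' ι' ι'' : Type*}
    [Fintype ι'] [Fintype κ'] [Fintype ν'] [DecidableEq κ'] [DecidableEq μ]
    (U : Matrix (ι' × κ') (ι × κ) ℂ) (V : Matrix (ι'' × ν') (ι' × μ) ℂ) (X : Matrix ι ι ℂ)
    (G : Matrix κ κ ℂ) (H : Matrix μ μ ℂ) :
    trSnd ((V ⊗ₖ (1 : Matrix κ' κ' ℂ)).submatrix (assocSwap ι'' ν' κ') (rightSwap ι' κ' μ) *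
      ((U ⊗ₖ (1 : Matrix μ μ ℂ)).submatrix (Equiv.refl _) (Equiv.prodAssoc ι κ μ).symm *
        (X ⊗ₖ (G ⊗ₖ H)) *
        ((U ⊗ₖ (1 : Matrix μ μ ℂ)).submatrix (Equiv.refl _) (Equiv.prodAssoc ι κ μ).symm)ᴴ) *
      ((V ⊗ₖ (1 : Matrix κ' κ' ℂ)).submatrix (assocSwap ι'' ν' κ') (rightSwap ι' κ' μ))ᴴ)
      = trSnd (V * (trSnd (U * (X ⊗ₖ G) * Uᴴ) ⊗ₖ H) * Vᴴ) := by
  have h1 : relabel (Equiv.prodAssoc ι κ μ).symm (X ⊗ₖ (G ⊗ₖ H)) = (X ⊗ₖ G) ⊗ₖ H := by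
    ext i j
    simp [relabel_apply, Matrix.kroneckerMap_apply, mul_assoc]
  have h2 : (U ⊗ₖ (1 : Matrix μ μ ℂ)) * ((X ⊗ₖ G) ⊗ₖ H) * (U ⊗ₖ (1 : Matrix μ μ ℂ))ᴴ
      = (U * (X ⊗ₖ G) * Uᴴ) ⊗ₖ H := by
    rw [Matrix.conjTranspose_kronecker, ← Matrix.mul_kronecker_mul, ← Matrix.mul_kronecker_mul,
      Matrix.conjTranspose_one, Matrix.mul_one, Matrix.one_mul]
  rw [conj_submatrix _ (Equiv.refl _), h1, h2, conj_submatrix, trSnd_assocSwap,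
    trSnd_conj_kronecker_one]
  change trSnd (V * trSnd (relabel (rightSwap ι' κ' μ) ((U * (X ⊗ₖ G) * Uᴴ) ⊗ₖ H)) * Vᴴ) = _
  rw [trSnd_rightSwap]

end Blocks

/-! ### Unitaries between different systems -/

section Unitary

variable {ι κ μ ν : Type*} [Fintype ι] [DecidableEq ι] [Fintype κ] [DecidableEq κ] [Fintype μ]
  [DecidableEq μ] [Fintype ν] [DecidableEq ν]

/-- `U` is a unitary between two systems. -/
def IsIsoUnitary (U : Matrix κ ι ℂ) : Prop := Uᴴ * U = 1 ∧ U * Uᴴ = 1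

lemma IsIsoUnitary.mul {U : Matrix κ ι ℂ} {V : Matrix μ κ ℂ} (hU : IsIsoUnitary U)
    (hV : IsIsoUnitary V) : IsIsoUnitary (V * U) := by
  constructor
  · rw [Matrix.conjTranspose_mul, Matrix.mul_assoc, ← Matrix.mul_assoc Vᴴ, hV.1, Matrix.one_mul,
      hU.1]
  · rw [Matrix.conjTranspose_mul, Matrix.mul_assoc, ← Matrix.mul_assoc U, hU.2, Matrix.one_mul,
      hV.2]

lemma IsIsoUnitary.submatrix {U : Matrix κ ι ℂ} (hU : IsIsoUnitary U) (e : μ ≃ κ) (f : ν ≃ ι) :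
    IsIsoUnitary (U.submatrix e f) := by
  constructor
  · rw [Matrix.conjTranspose_submatrix, Matrix.submatrix_mul_equiv, hU.1,
      Matrix.submatrix_one_equiv]
  · rw [Matrix.conjTranspose_submatrix, Matrix.submatrix_mul_equiv, hU.2,
      Matrix.submatrix_one_equiv]

lemma IsIsoUnitary.kronecker_one {U : Matrix κ ι ℂ} (hU : IsIsoUnitary U) :
    IsIsoUnitary (U ⊗ₖ (1 : Matrix μ μ ℂ)) := by
  constructor
  · rw [Matrix.conjTranspose_kronecker, ← Matrix.mul_kronecker_mul, hU.1,
      Matrix.conjTranspose_one, Matrix.mul_one, Matrix.one_kronecker_one]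
  · rw [Matrix.conjTranspose_kronecker, ← Matrix.mul_kronecker_mul, hU.2,
      Matrix.conjTranspose_one, Matrix.mul_one, Matrix.one_kronecker_one]

lemma isIsoUnitary_one : IsIsoUnitary (1 : Matrix ι ι ℂ) := by
  simp [IsIsoUnitary]

end Unitary

/-! ### Gibbs states and energy conservation -/

section Energy

variable {ι κ : Type} [Fintype ι] [Fintype κ]

/-- The partition function. -/
def partition (β : ℝ) (E : Energies ι) : ℝ := ∑ i, Real.exp (-β * E i)

lemma partition_pos [Nonempty ι] (β : ℝ) (E : Energies ι) : 0 < partition β E :=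
  Finset.sum_pos (fun _ _ => Real.exp_pos _) Finset.univ_nonempty

lemma partition_addEnergies (β : ℝ) (E : Energies ι) (F : Energies κ) :
    partition β (addEnergies E F) = partition β E * partition β F := by
  simp only [partition, addEnergies, Fintype.sum_prod_type, Finset.sum_mul_sum, mul_add,
    Real.exp_add]

variable [DecidableEq ι] [DecidableEq κ]

/-- In the energy eigenbases conservation is an entrywise selection rule, which makes it easy to
check for products and permutations. -/
lemma mul_hamiltonian_iff {E : Energies ι} {F : Energies κ} {U : Matrix κ ι ℂ} :
    U * hamiltonian E = hamiltonian F * U ↔ ∀ x y, U x y ≠ 0 → F x = E y := by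
  rw [← Matrix.ext_iff]
  refine forall₂_congr fun x y => ?_
  rw [hamiltonian, hamiltonian, Matrix.mul_diagonal, Matrix.diagonal_mul, mul_comm,
    mul_eq_mul_right_iff, Complex.ofReal_inj]
  constructor
  · rintro (h | h) h'
    · exact h.symm
    · exact absurd h h'
  · intro h
    by_cases h' : U x y = 0
    · exact Or.inr h'
    · exact Or.inl (h h').symm

lemma gibbs_addEnergies (β : ℝ) (E : Energies ι) (F : Energies κ) :
    gibbs β (addEnergies E F) = gibbs β E ⊗ₖ gibbs β F := by
  rw [gibbs, gibbs, gibbs, Matrix.diagonal_kronecker_diagonal]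
  congr 1
  ext x
  have := partition_addEnergies β E F
  simp only [partition] at this
  rw [this, ← Complex.ofReal_mul, div_mul_div_comm, ← Real.exp_add]
  simp only [addEnergies, mul_add]

lemma gibbs_apply_self (β : ℝ) (E : Energies ι) (i : ι) :
    gibbs β E i i = ((Real.exp (-β * E i) / partition β E : ℝ) : ℂ) :=
  Matrix.diagonal_apply_eq _ _

lemma isState_gibbs [Nonempty ι] (β : ℝ) (E : Energies ι) : IsState (gibbs β E) := by
  constructor
  · refine Matrix.PosSemidef.diagonal fun i => ?_
    exact Complex.zero_le_real.2
      (div_nonneg (Real.exp_pos _).le (Finset.sum_nonneg fun _ _ => (Real.exp_pos _).le))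
  · have h : ∑ i, Real.exp (-β * E i) / partition β E = 1 := by
      rw [← Finset.sum_div]
      exact div_self (partition_pos β E).ne'
    rw [gibbs, Matrix.trace_diagonal, ← Complex.ofReal_sum, ← Complex.ofReal_one]
    exact congrArg _ h

/-- Energy-conserving unitaries preserve Gibbs states. -/
lemma conj_gibbs {E : Energies ι} {F : Energies κ} {U : Matrix κ ι ℂ} (hU : IsIsoUnitary U)
    (hE : U * hamiltonian E = hamiltonian F * U) (β : ℝ) :
    U * gibbs β E * Uᴴ = gibbs β F := by
  rw [mul_hamiltonian_iff] at hE
  -- The normalisation `c` is kept free: `c = 1` and a trace first show that the partition functions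
  -- agree, and only then is `c` set to their common value.
  have hw : ∀ c : ℝ, U * Matrix.diagonal (fun i => ((Real.exp (-β * E i) / c : ℝ) : ℂ)) * Uᴴ
      = Matrix.diagonal fun k => ((Real.exp (-β * F k) / c : ℝ) : ℂ) := by
    intro c
    have : U * Matrix.diagonal (fun i => ((Real.exp (-β * E i) / c : ℝ) : ℂ))
        = Matrix.diagonal (fun k => ((Real.exp (-β * F k) / c : ℝ) : ℂ)) * U := by
      ext x y
      rw [Matrix.mul_diagonal, Matrix.diagonal_mul, mul_comm]
      by_cases h : U x y = 0
      · simp [h]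
      · rw [hE x y h]
    rw [this, Matrix.mul_assoc, hU.2, Matrix.mul_one]
  have hZ : partition β E = partition β F := by
    have h := congrArg Matrix.trace (hw 1)
    rw [Matrix.trace_mul_comm, ← Matrix.mul_assoc, hU.1, Matrix.one_mul, Matrix.trace_diagonal,
      Matrix.trace_diagonal] at h
    simp only [div_one] at h
    exact_mod_cast h
  have := hw (partition β E)
  conv_rhs at this => rw [hZ]
  exact this

end Energy

/-! ### Thermal operations and their closure -/

section ThermalOp

variable {β : ℝ} {A A' A'' : Sys Energies}

/-- The thermal operation given by a bijection `A ⊗ B ≃ A' ⊗ B'` of the energy eigenbases. -/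
def permOp (β : ℝ) (B B' : Sys Energies) (f : A.ι × B.ι ≃ A'.ι × B'.ι) :
    Matrix A.ι A.ι ℂ →ₗ[ℂ] Matrix A'.ι A'.ι ℂ where
  toFun X := trSnd (relabel f (X ⊗ₖ gibbs β B.label))
  map_add' X Y := by
    ext i j
    simp [trSnd, relabel_apply, Matrix.kroneckerMap_apply, add_mul, Finset.sum_add_distrib]
  map_smul' c X := by
    ext i j
    simp [trSnd, relabel_apply, Matrix.kroneckerMap_apply, mul_assoc, Finset.mul_sum]

lemma isThermalOp_permOp {B B' : Sys Energies} {f : A.ι × B.ι ≃ A'.ι × B'.ι}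
    (hf : ∀ x, addEnergies A'.label B'.label (f x) = addEnergies A.label B.label x) :
    IsThermalOp β A A' (permOp β B B' f) := by
  have hU := isIsoUnitary_one (ι := A'.ι × B'.ι).submatrix (Equiv.refl _) f
  refine ⟨B, B', _, hU.1, hU.2, mul_hamiltonian_iff.2 fun x y h => ?_, fun X => ?_⟩
  · have : x = f y := by
      by_contra hne
      exact h (Matrix.one_apply_ne hne)
    rw [this, hf]
  · rw [conj_submatrix, Matrix.one_mul, Matrix.conjTranspose_one, Matrix.mul_one]
    rfl

lemma gibbs_unit (β : ℝ) : gibbs β (fun _ : Unit => 0) = 1 := by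
  ext i j
  simp [gibbs]

lemma isThermalOp_relabel {e : A.ι ≃ A'.ι} (he : ∀ i, A'.label (e i) = A.label i) :
    IsThermalOp β A A' (relabel e) := by
  convert isThermalOp_permOp (β := β) (A := A) (A' := A') (B := ⟨Unit, fun _ => 0⟩)
    (B' := ⟨Unit, fun _ => 0⟩) (f := e.prodCongr (Equiv.refl Unit)) fun x => by
      simp [addEnergies, he] using 1
  ext X i j
  simp only [permOp, gibbs_unit]
  simp [trSnd, relabel_apply, Matrix.kroneckerMap_apply]

lemma IsThermalOp.comp {Λ : Matrix A.ι A.ι ℂ →ₗ[ℂ] Matrix A'.ι A'.ι ℂ}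
    {Γ : Matrix A'.ι A'.ι ℂ →ₗ[ℂ] Matrix A''.ι A''.ι ℂ} (hΛ : IsThermalOp β A A' Λ)
    (hΓ : IsThermalOp β A' A'' Γ) : IsThermalOp β A A'' (Γ ∘ₗ Λ) := by
  obtain ⟨B, B', U, hU1, hU2, hUE, hΛ⟩ := hΛ
  obtain ⟨C, C', V, hV1, hV2, hVE, hΓ⟩ := hΓ
  rw [mul_hamiltonian_iff] at hUE hVE
  have hU : IsIsoUnitary ((U ⊗ₖ (1 : Matrix C.ι C.ι ℂ)).submatrix (Equiv.refl _)
      (Equiv.prodAssoc A.ι B.ι C.ι).symm) :=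
    (IsIsoUnitary.kronecker_one ⟨hU1, hU2⟩).submatrix _ _
  have hV : IsIsoUnitary ((V ⊗ₖ (1 : Matrix B'.ι B'.ι ℂ)).submatrix (assocSwap A''.ι C'.ι B'.ι)
      (rightSwap A'.ι B'.ι C.ι)) :=
    (IsIsoUnitary.kronecker_one ⟨hV1, hV2⟩).submatrix _ _
  have hW := hU.mul hV
  refine ⟨⟨B.ι × C.ι, addEnergies B.label C.label⟩, ⟨B'.ι × C'.ι, addEnergies B'.label C'.label⟩,
    _, hW.1, hW.2, mul_hamiltonian_iff.2 fun x y h => ?_, fun X => ?_⟩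
  -- A nonzero entry of the product passes through some basis state `z` at which both factors are
  -- nonzero, so energy is conserved in both steps.
  · obtain ⟨z, -, hz⟩ := Finset.exists_ne_zero_of_sum_ne_zero h
    have hz1 := left_ne_zero_of_mul hz
    have hz2 := right_ne_zero_of_mul hz
    have e1 := hVE (assocSwap A''.ι C'.ι B'.ι x).1 (rightSwap A'.ι B'.ι C.ι z).1
      (left_ne_zero_of_mul hz1)
    have e2 : x.2.1 = z.1.2 := by
      by_contra hne
      exact right_ne_zero_of_mul hz1 (Matrix.one_apply_ne hne)
    have e3 := hUE z.1 ((Equiv.prodAssoc A.ι B.ι C.ι).symm y).1 (left_ne_zero_of_mul hz2)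
    have e4 : z.2 = y.2.2 := by
      by_contra hne
      exact right_ne_zero_of_mul hz2 (Matrix.one_apply_ne hne)
    simp only [addEnergies, assocSwap, rightSwap, Equiv.coe_fn_mk, Equiv.prodAssoc_symm_apply] at e1 e3 ⊢
    rw [e2, ← e4]
    linarith
  · have h := conj_dilation_mul U V X (gibbs β B.label) (gibbs β C.label)
    rw [← gibbs_addEnergies, ← hΛ, ← hΓ] at h
    rw [LinearMap.comp_apply, ← h, Matrix.conjTranspose_mul]
    simp only [Matrix.mul_assoc]

lemma IsThermalOp.tensor_id {Λ : Matrix A.ι A.ι ℂ →ₗ[ℂ] Matrix A'.ι A'.ι ℂ}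
    (hΛ : IsThermalOp β A A' Λ) (C : Sys Energies) :
    IsThermalOp β ⟨A.ι × C.ι, addEnergies A.label C.label⟩
      ⟨A'.ι × C.ι, addEnergies A'.label C.label⟩ (tensorId C.ι Λ) := by
  obtain ⟨B, B', U, hU1, hU2, hUE, hΛ⟩ := hΛ
  rw [mul_hamiltonian_iff] at hUE
  have hW : IsIsoUnitary ((U ⊗ₖ (1 : Matrix C.ι C.ι ℂ)).submatrix
      (rightSwap A'.ι C.ι B'.ι) (rightSwap A.ι C.ι B.ι)) :=
    (IsIsoUnitary.kronecker_one ⟨hU1, hU2⟩).submatrix _ _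
  refine ⟨B, B', _, hW.1, hW.2, mul_hamiltonian_iff.2 fun x y h => ?_, fun X => ?_⟩
  · have e1 := hUE (rightSwap A'.ι C.ι B'.ι x).1 (rightSwap A.ι C.ι B.ι y).1
      (left_ne_zero_of_mul h)
    have e2 : x.1.2 = y.1.2 := by
      by_contra hne
      exact right_ne_zero_of_mul h (Matrix.one_apply_ne hne)
    simp only [addEnergies, rightSwap, Equiv.coe_fn_mk] at e1 ⊢
    rw [e2]
    linarith
  · ext a b
    have h1 := hΛ (Matrix.of fun i j => X (i, a.2) (j, b.2))
    have h2 := block_conj_kronecker_one U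
      (relabel (rightSwap A.ι C.ι B.ι) (X ⊗ₖ gibbs β B.label)) a.2 b.2
    rw [conj_submatrix]
    exact (congrFun (congrFun h1 a.1) b.1).trans
      (congrFun (congrFun (congrArg trSnd h2) a.1) b.1).symm

lemma IsThermalOp.posSemidef {Λ : Matrix A.ι A.ι ℂ →ₗ[ℂ] Matrix A'.ι A'.ι ℂ}
    (hΛ : IsThermalOp β A A' Λ) {X : Matrix A.ι A.ι ℂ} (hX : X.PosSemidef) :
    (Λ X).PosSemidef := by
  obtain ⟨B, B', U, -, -, -, hΛ⟩ := hΛ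
  rw [hΛ]
  exact posSemidef_trSnd ((hX.kronecker (isState_gibbs β B.label).1).mul_mul_conjTranspose_same U)

lemma IsThermalOp.map_gibbs {Λ : Matrix A.ι A.ι ℂ →ₗ[ℂ] Matrix A'.ι A'.ι ℂ}
    (hΛ : IsThermalOp β A A' Λ) : Λ (gibbs β A.label) = gibbs β A'.label := by
  obtain ⟨B, B', U, hU1, hU2, hUE, hΛ⟩ := hΛ
  rw [hΛ, ← gibbs_addEnergies, conj_gibbs ⟨hU1, hU2⟩ hUE, gibbs_addEnergies, trSnd_kronecker,
    (isState_gibbs β B'.label).2, one_smul]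

lemma IsThermalOp.isThermal {Λ : Matrix A.ι A.ι ℂ →ₗ[ℂ] Matrix A'.ι A'.ι ℂ}
    (hΛ : IsThermalOp β A A' Λ) : IsThermal β A A' Λ :=
  ⟨fun _ => Λ, fun _ => hΛ, fun _ => tendsto_const_nhds⟩

lemma IsThermal.posSemidef {Λ : Matrix A.ι A.ι ℂ →ₗ[ℂ] Matrix A'.ι A'.ι ℂ}
    (hΛ : IsThermal β A A' Λ) {X : Matrix A.ι A.ι ℂ} (hX : X.PosSemidef) :
    (Λ X).PosSemidef := by
  obtain ⟨Λs, hΛs, hlim⟩ := hΛ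
  exact isClosed_posSemidef.mem_of_tendsto (hlim X)
    (Filter.Eventually.of_forall fun k => (hΛs k).posSemidef hX)

lemma IsThermal.map_gibbs {Λ : Matrix A.ι A.ι ℂ →ₗ[ℂ] Matrix A'.ι A'.ι ℂ}
    (hΛ : IsThermal β A A' Λ) : Λ (gibbs β A.label) = gibbs β A'.label := by
  obtain ⟨Λs, hΛs, hlim⟩ := hΛ
  refine tendsto_nhds_unique (hlim _) ?_
  simp only [fun k => (hΛs k).map_gibbs]
  exact tendsto_const_nhds

/-- A linear map is determined by finitely many matrix units, so pointwise convergence of maps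
allows the argument to vary too. Hence sequences of thermal operations can be composed term by term.
-/
lemma tendsto_apply_of_tendsto {ι κ : Type*} [Fintype ι] [DecidableEq ι]
    {Γs : ℕ → (Matrix ι ι ℂ →ₗ[ℂ] Matrix κ κ ℂ)} {Γ : Matrix ι ι ℂ →ₗ[ℂ] Matrix κ κ ℂ}
    (hΓ : ∀ X, Filter.Tendsto (fun k => Γs k X) Filter.atTop (𝓝 (Γ X)))
    {Xs : ℕ → Matrix ι ι ℂ} {X : Matrix ι ι ℂ} (hX : Filter.Tendsto Xs Filter.atTop (𝓝 X)) :
    Filter.Tendsto (fun k => Γs k (Xs k)) Filter.atTop (𝓝 (Γ X)) := by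
  have key : ∀ (Γ : Matrix ι ι ℂ →ₗ[ℂ] Matrix κ κ ℂ) (X : Matrix ι ι ℂ),
      Γ X = ∑ i, ∑ j, X i j • Γ (Matrix.single i j 1) := by
    intro Γ X
    conv_lhs => rw [Matrix.matrix_eq_sum_single X]
    simp only [map_sum]
    refine Finset.sum_congr rfl fun i _ => Finset.sum_congr rfl fun j _ => ?_
    rw [← map_smul, Matrix.smul_single, smul_eq_mul, mul_one]
  simp only [key (Γs _) (Xs _)]
  rw [key Γ X]
  refine tendsto_finsetSum _ fun i _ => tendsto_finsetSum _ fun j _ => ?_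
  exact ((tendsto_pi_nhds.1 (tendsto_pi_nhds.1 hX i)) j).smul (hΓ _)

lemma IsThermal.comp {Λ : Matrix A.ι A.ι ℂ →ₗ[ℂ] Matrix A'.ι A'.ι ℂ}
    {Γ : Matrix A'.ι A'.ι ℂ →ₗ[ℂ] Matrix A''.ι A''.ι ℂ} (hΛ : IsThermal β A A' Λ)
    (hΓ : IsThermal β A' A'' Γ) : IsThermal β A A'' (Γ ∘ₗ Λ) := by
  obtain ⟨Λs, hΛs, hΛ⟩ := hΛ
  obtain ⟨Γs, hΓs, hΓ⟩ := hΓ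
  exact ⟨fun k => Γs k ∘ₗ Λs k, fun k => (hΛs k).comp (hΓs k),
    fun X => tendsto_apply_of_tendsto hΓ (hΛ X)⟩

lemma IsThermal.tensor_id {Λ : Matrix A.ι A.ι ℂ →ₗ[ℂ] Matrix A'.ι A'.ι ℂ}
    (hΛ : IsThermal β A A' Λ) (C : Sys Energies) :
    IsThermal β ⟨A.ι × C.ι, addEnergies A.label C.label⟩
      ⟨A'.ι × C.ι, addEnergies A'.label C.label⟩ (tensorId C.ι Λ) := by
  obtain ⟨Λs, hΛs, hΛ⟩ := hΛ
  refine ⟨fun k => tensorId C.ι (Λs k), fun k => (hΛs k).tensor_id C, fun X => ?_⟩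
  refine tendsto_pi_nhds.2 fun a => tendsto_pi_nhds.2 fun b => ?_
  exact tendsto_pi_nhds.1 (tendsto_pi_nhds.1 (hΛ _) a.1) b.1

lemma isThermal_relabel {e : A.ι ≃ A'.ι} (he : ∀ i, A'.label (e i) = A.label i) :
    IsThermal β A A' (relabel e) :=
  (isThermalOp_relabel he).isThermal

end ThermalOp

lemma thermo_hasRearrangements (β : ℝ) : (thermo β).HasRearrangements where
  comp := IsThermal.comp
  tensor_id C h := IsThermal.tensor_id h C
  assoc A B C := isThermal_relabel fun x =>
    (add_assoc (A.label x.1.1) (B.label x.1.2) (C.label x.2)).symm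
  assoc_symm A B C := isThermal_relabel fun x =>
    add_assoc (A.label x.1) (B.label x.2.1) (C.label x.2.2)
  unitor A := isThermal_relabel fun x => (add_zero (A.label x.1)).symm
  unitor_symm A := isThermal_relabel fun x => add_zero (A.label x)
  swap A B := isThermal_relabel fun x => add_comm (B.label x.2) (A.label x.1)

/-! ### Lower bound on the work cost -/

section Converse

open Theory

variable {β : ℝ}

lemma gibbs_pow (A : Sys (thermo β).Label) :
    ∀ n, gibbs β (pow A n).label = powState (gibbs β A.label) n
  | 0 => gibbs_unit β
  | n + 1 => (gibbs_addEnergies β (pow A n).label A.label).trans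
      (congrArg (· ⊗ₖ gibbs β A.label) (gibbs_pow A n))

lemma card_pow {T : Theory} (A : Sys T.Label) :
    ∀ n, Fintype.card (pow A n).ι = Fintype.card A.ι ^ n
  | 0 => Fintype.card_unit
  | n + 1 => by
    rw [pow_succ, ← card_pow A n]
    exact Fintype.card_prod (pow A n).ι A.ι

lemma label_pow_workBit (m : ℕ) (i : (pow (qubit β 0) m).ι) :
    (pow (qubit β 0) m).label i = (0 : ℝ) := by
  induction m with
  | zero => rfl
  | succ m ih => exact (congrArg (· + (0 : ℝ)) (ih i.1)).trans (add_zero 0)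

lemma exists_powState_workBit (β : ℝ) (m : ℕ) :
    ∃ x, powState (workBit β) m = Matrix.single x x 1 := by
  induction m with
  | zero =>
    refine ⟨(), ?_⟩
    ext i j
    change (1 : Matrix Unit Unit ℂ) () () = (Matrix.single () () 1 : Matrix Unit Unit ℂ) () ()
    simp
  | succ m ih =>
    obtain ⟨x, hx⟩ := ih
    refine ⟨(x, (0 : Fin 2)), ?_⟩
    have := Matrix.single_kronecker_single x x (0 : Fin 2) (0 : Fin 2) (1 : ℂ) (1 : ℂ)
    rw [mul_one, ← hx] at this
    exact this

lemma gibbs_of_label_eq_zero {ι : Type} [Fintype ι] [DecidableEq ι] (β : ℝ) {E : Energies ι}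
    (h : ∀ i, E i = 0) : gibbs β E = ((Fintype.card ι : ℂ))⁻¹ • (1 : Matrix ι ι ℂ) := by
  ext i j
  by_cases hij : i = j <;> simp [gibbs, h, hij]

lemma posSemidef_one_sub_single {ι : Type*} [Fintype ι] [DecidableEq ι] (x : ι) :
    ((1 : Matrix ι ι ℂ) - Matrix.single x x 1).PosSemidef := by
  have : (1 : Matrix ι ι ℂ) - Matrix.single x x 1
      = Matrix.diagonal fun i => if i = x then 0 else 1 := by
    ext i j
    by_cases hij : i = j
    · subst hij
      by_cases hx : i = x
      · simp [hx]
      · simp [hx, Matrix.single_apply_of_row_ne (Ne.symm hx)]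
    · rw [Matrix.diagonal_apply_ne _ hij, Matrix.sub_apply, Matrix.one_apply_ne hij]
      by_cases hx : x = i
      · rw [Matrix.single_apply_of_col_ne _ _ (fun h => hij (hx.symm.trans h)), sub_zero]
      · rw [Matrix.single_apply_of_row_ne hx, sub_zero]
  rw [this]
  refine Matrix.PosSemidef.diagonal fun i => ?_
  by_cases h : i = x <;> simp [h]

/-- What thermal operations make of `m` units of work is at most `2 ^ m` times the Gibbs state. -/
lemma posSemidef_of_isThermal_workBit {A : Sys (thermo β).Label} {m : ℕ}
    {Λ : Matrix (pow (qubit β 0) m).ι (pow (qubit β 0) m).ι ℂ →ₗ[ℂ] Matrix A.ι A.ι ℂ}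
    (hΛ : IsThermal β (pow (qubit β 0) m) A Λ) :
    ((2 ^ m : ℂ) • gibbs β A.label - Λ (powState (workBit β) m)).PosSemidef := by
  obtain ⟨x, hx⟩ := exists_powState_workBit β m
  have hcard : ((Fintype.card (pow (qubit β 0) m).ι : ℕ) : ℂ) = 2 ^ m := by
    rw [card_pow]
    have : Fintype.card (qubit β 0).ι = 2 := Fintype.card_fin 2
    rw [this]
    push_cast
    rfl
  -- The Hamiltonian of the work bits vanishes, so the identity is `2 ^ m` times their Gibbs state
  -- and dominates the pure state; `Λ` preserves this comparison.
  have h1 := hΛ.map_gibbs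
  rw [gibbs_of_label_eq_zero β (label_pow_workBit m), hcard] at h1
  have h2 := hΛ.posSemidef (posSemidef_one_sub_single x)
  rw [map_sub, ← hx] at h2
  rwa [← h1, map_smul, smul_smul, mul_inv_cancel₀ (by positivity), one_smul]

lemma exists_powState_apply {T : Theory} {A : Sys T.Label} (i : A.ι) (n : ℕ) :
    ∃ x, ∀ ρ : Matrix A.ι A.ι ℂ, powState ρ n x x = ρ i i ^ n := by
  induction n with
  | zero => exact ⟨(), fun ρ => by rw [pow_zero]; exact Matrix.one_apply_eq ()⟩
  | succ n ih =>
    obtain ⟨x, hx⟩ := ih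
    exact ⟨(x, i), fun ρ => by rw [pow_succ, ← hx]; rfl⟩

/-- The bound `ρ^{⊗n} ≤ 2 ^ m γ^{⊗n}` is read off at the diagonal entry `(i, …, i)`. An `n`-th root
removes the dependence on `n`, and then `δ → 0`. -/
lemma apply_le_of_achievable {A : Sys (thermo β).Label} {ρ : Matrix A.ι A.ι ℂ} {r : ℝ}
    (hρ : ρ.PosSemidef) (h : Achievable (T := thermo β) (workBit β) ρ r) (i : A.ι) :
    (ρ i i).re ≤ (2 : ℝ) ^ r * (gibbs β A.label i i).re := by
  have hg : gibbs β A.label i i = (((gibbs β A.label i i).re : ℝ) : ℂ) :=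
    Complex.eq_re_of_ofReal_le (r := 0) (by
      simpa using (isState_gibbs β A.label).1.diag_nonneg (i := i))
  have hr : ρ i i = (((ρ i i).re : ℝ) : ℂ) :=
    Complex.eq_re_of_ofReal_le (r := 0) (by simpa using hρ.diag_nonneg (i := i))
  have hr0 : 0 ≤ (ρ i i).re := (Complex.nonneg_iff.1 hρ.diag_nonneg).1
  have hg0 : 0 ≤ (gibbs β A.label i i).re :=
    (Complex.nonneg_iff.1 (isState_gibbs β A.label).1.diag_nonneg).1
  set a := (ρ i i).re
  set g := (gibbs β A.label i i).re
  have hbound : ∀ δ : ℝ, 0 < δ → a ≤ (2 : ℝ) ^ (r + δ) * g := by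
    intro δ hδ
    obtain ⟨m, n, hn, hmn, Λ, hΛ, hΛρ⟩ := h δ hδ
    have h1 := posSemidef_of_isThermal_workBit hΛ
    rw [hΛρ, gibbs_pow] at h1
    obtain ⟨x, hx⟩ := exists_powState_apply i n
    have h2 := h1.diag_nonneg (i := x)
    rw [Matrix.sub_apply, Matrix.smul_apply, hx, hx, hg, hr, sub_nonneg, smul_eq_mul] at h2
    have h3 : a ^ n ≤ 2 ^ m * g ^ n := by exact_mod_cast h2
    have h4 : (2 : ℝ) ^ m ≤ ((2 : ℝ) ^ (r + δ)) ^ n := by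
      rw [← Real.rpow_natCast, ← Real.rpow_natCast, ← Real.rpow_mul zero_le_two]
      refine Real.rpow_le_rpow_of_exponent_le one_le_two ?_
      exact (div_le_iff₀ (by exact_mod_cast hn)).1 hmn
    refine le_of_pow_le_pow_left₀ hn.ne' (by positivity) (h3.trans ?_)
    rw [mul_pow]
    gcongr
  have hlim : Filter.Tendsto (fun δ : ℝ => (2 : ℝ) ^ (r + δ) * g) (𝓝[>] 0)
      (𝓝 ((2 : ℝ) ^ (r + 0) * g)) := by
    refine Filter.Tendsto.mono_left ?_ nhdsWithin_le_nhds
    refine Continuous.tendsto (f := fun δ : ℝ => (2 : ℝ) ^ (r + δ) * g) ?_ 0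
    exact (continuous_const.rpow (continuous_const.add continuous_id)
      fun _ => Or.inl two_ne_zero).mul continuous_const
  rw [add_zero] at hlim
  exact ge_of_tendsto hlim (eventually_nhdsWithin_of_forall fun δ hδ => hbound δ hδ)

end Converse

/-! ### Shell-preserving permutations with prescribed allocations -/

section Combinatorics

/-- Two injections into a finite type that agree with respect to a labelling are related by a
label-preserving permutation. -/
lemma exists_perm_extending {P X γ : Type*} [Finite X] (f : X → γ) {u v : P → X}
    (hu : Function.Injective u) (hv : Function.Injective v) (huv : ∀ p, f (u p) = f (v p)) :
    ∃ σ : Equiv.Perm X, (∀ x, f (σ x) = f x) ∧ ∀ p, σ (u p) = v p := by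
  classical
  -- Fibre by fibre: a bijection between two subsets of a finite set extends to a permutation of it.
  have key : ∀ c : γ, ∃ σ : Equiv.Perm {x // f x = c},
      ∀ p (h : f (u p) = c), σ ⟨u p, h⟩ = ⟨v p, (huv p).symm.trans h⟩ := by
    intro c
    let u' : {p // f (u p) = c} → {x // f x = c} := fun p => ⟨u p.1, p.2⟩
    let v' : {p // f (u p) = c} → {x // f x = c} := fun p => ⟨v p.1, (huv p.1).symm.trans p.2⟩
    have hu' : Function.Injective u' := fun p q h => Subtype.ext (hu (congrArg Subtype.val h))
    have hv' : Function.Injective v' := fun p q h => Subtype.ext (hv (congrArg Subtype.val h))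
    let e : {x // x ∈ Set.range u'} ≃ {x // x ∈ Set.range v'} :=
      (Equiv.ofInjective u' hu').symm.trans (Equiv.ofInjective v' hv')
    refine ⟨e.extendSubtype, fun p h => ?_⟩
    rw [e.extendSubtype_apply_of_mem _ (Set.mem_range_self (f := u') ⟨p, h⟩)]
    have : (Equiv.ofInjective u' hu').symm ⟨u' ⟨p, h⟩, Set.mem_range_self _⟩ = ⟨p, h⟩ :=
      Equiv.ofInjective_symm_apply hu' _
    simp only [e, Equiv.trans_apply]
    exact congrArg (fun y => ((Equiv.ofInjective v' hv') y).1) this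
  choose σ hσ using key
  refine ⟨Equiv.ofFiberEquiv σ, fun x => Equiv.ofFiberEquiv_map σ x, fun p => ?_⟩
  exact congrArg Subtype.val (hσ (f (u p)) p rfl)

variable {ι κ μ : Type*} [Fintype ι] [DecidableEq ι] [Fintype κ] [Fintype μ] [DecidableEq μ]

/-- Moving prescribed numbers `c j a` of the elements of the shell `j` in the sector `x₀` to
the label `a`, by a shell-preserving bijection. -/
lemma exists_allocation (x₀ : ι) (k : κ → ℕ) (l : μ → ℕ) (J : Finset ℕ) (c : ℕ → κ → ℕ)
    (h₁ : ∀ j ∈ J, ∑ a, c j a ≤ ∑ a, Fintype.card {b // k a + l b = j})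
    (h₂ : ∀ j ∈ J, ∀ a, c j a ≤ Fintype.card ι * Fintype.card {b // k a + l b = j}) :
    ∃ f : ι × (κ × μ) ≃ κ × (ι × μ),
      (∀ y, k (f y).1 + l (f y).2.2 = k y.2.1 + l y.2.2) ∧
      ∀ w : ℕ → ℝ, (∀ j, 0 ≤ w j) → ∀ a,
        ∑ j ∈ J, (c j a : ℝ) * w j
          ≤ ∑ b : ι × μ, if (f.symm (a, b)).1 = x₀ then w (k a + l b.2) else 0 := by
  have hu : ∀ j : J, Nonempty ((Σ a, Fin (c j a)) ↪ {y : κ × μ // k y.1 + l y.2 = j}) := by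
    intro j
    refine Function.Embedding.nonempty_of_card_le ?_
    rw [Fintype.card_sigma]
    simp only [Fintype.card_fin]
    refine (h₁ j j.2).trans_eq ?_
    rw [← Fintype.card_sigma]
    refine Fintype.card_congr ⟨fun y => ⟨(y.1, y.2.1), y.2.2⟩, fun y => ⟨y.1.1, y.1.2, y.2⟩,
      fun _ => rfl, fun _ => rfl⟩
  have hv : ∀ (j : J) (a : κ), Nonempty (Fin (c j a) ↪ ι × {b // k a + l b = (j : ℕ)}) := by
    intro j a
    refine Function.Embedding.nonempty_of_card_le ?_
    rw [Fintype.card_prod, Fintype.card_fin]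
    exact h₂ j j.2 a
  let u' := fun j => (hu j).some
  let v' := fun j a => (hv j a).some
  let e₀ : ι × (κ × μ) ≃ κ × (ι × μ) :=
    ⟨fun y => (y.2.1, (y.1, y.2.2)), fun y => (y.2.1, (y.1, y.2.2)), fun _ => rfl, fun _ => rfl⟩
  -- `U` enumerates the source states to be moved, all in the sector `x₀`; `V` enumerates their
  -- destinations with the prescribed labels. Both respect the shells, and where all other states go
  -- is irrelevant.
  let U : (Σ j : J, Σ a, Fin (c j a)) → κ × (ι × μ) := fun p => e₀ (x₀, (u' p.1 p.2).1)
  let V : (Σ j : J, Σ a, Fin (c j a)) → κ × (ι × μ) :=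
    fun p => (p.2.1, ((v' p.1 p.2.1 p.2.2).1, (v' p.1 p.2.1 p.2.2).2.1))
  let F : κ × (ι × μ) → ℕ := fun y => k y.1 + l y.2.2
  have hFU : ∀ p, F (U p) = p.1 := fun p => (u' p.1 p.2).2
  have hFV : ∀ p, F (V p) = p.1 := fun p => (v' p.1 p.2.1 p.2.2).2.2
  have hUinj : Function.Injective U := by
    rintro ⟨j, p⟩ ⟨j', p'⟩ h
    have hj : j = j' := Subtype.ext ((hFU ⟨j, p⟩).symm.trans ((congrArg F h).trans (hFU _)))
    subst hj
    have h' := e₀.injective h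
    have : p = p' := (u' j).injective (Subtype.ext (congrArg Prod.snd h'))
    rw [this]
  have hVinj : Function.Injective V := by
    rintro ⟨j, a, p⟩ ⟨j', a', p'⟩ h
    have hj : j = j' := Subtype.ext ((hFV ⟨j, a, p⟩).symm.trans ((congrArg F h).trans (hFV _)))
    subst hj
    have ha : a = a' := congrArg Prod.fst h
    subst ha
    have h₁ : (v' j a p).1 = (v' j a p').1 := congrArg (fun y => y.2.1) h
    have h₂ : (v' j a p).2.1 = (v' j a p').2.1 := congrArg (fun y => y.2.2) h
    have : p = p' := (v' j a).injective (Prod.ext h₁ (Subtype.ext h₂))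
    rw [this]
  obtain ⟨σ, hσF, hσ⟩ := exists_perm_extending F hUinj hVinj
    fun p => (hFU p).trans (hFV p).symm
  refine ⟨e₀.trans σ, fun y => hσF (e₀ y), fun w hw a => ?_⟩
  -- The states deliberately sent to `a` form only part of those arriving there from the sector
  -- `x₀`, whence an inequality.
  let g : (Σ j : J, Fin (c j a)) → ι × μ := fun p => (V ⟨p.1, a, p.2⟩).2
  have hg : Function.Injective g := by
    rintro ⟨j, p⟩ ⟨j', p'⟩ h
    have := hVinj (a₁ := ⟨j, a, p⟩) (a₂ := ⟨j', a, p'⟩) (Prod.ext rfl h)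
    obtain ⟨h1, h2⟩ := Sigma.mk.inj_iff.1 this
    subst h1
    simpa using h2
  have hval : ∀ p, (((e₀.trans σ).symm (a, g p)).1 = x₀) ∧ k a + l (g p).2 = p.1 := by
    intro p
    have h1 : (e₀.trans σ).symm (a, g p) = (x₀, (u' p.1 ⟨a, p.2⟩).1) := by
      rw [Equiv.symm_apply_eq]
      exact (hσ ⟨p.1, a, p.2⟩).symm
    exact ⟨by rw [h1], hFV ⟨p.1, a, p.2⟩⟩
  calc ∑ j ∈ J, (c j a : ℝ) * w j
      = ∑ p : (Σ j : J, Fin (c j a)), w p.1 := by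
        rw [Fintype.sum_sigma, ← Finset.sum_coe_sort J]
        simp
    _ = ∑ p : (Σ j : J, Fin (c j a)),
          (if ((e₀.trans σ).symm (a, g p)).1 = x₀ then w (k a + l (g p).2) else 0) := by
        refine Finset.sum_congr rfl fun p _ => ?_
        rw [if_pos (hval p).1, (hval p).2]
    _ ≤ _ := by
        rw [← Finset.sum_image (s := Finset.univ) (g := g)
          (f := fun b => if ((e₀.trans σ).symm (a, b)).1 = x₀ then w (k a + l b.2) else 0)
          fun _ _ _ _ h => hg h]
        refine Finset.sum_le_univ_sum_of_nonneg fun b => ?_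
        split_ifs
        · exact hw _
        · exact le_rfl

end Combinatorics

/-! ### Limits of bounded sequences of maps -/

section Compactness

variable {ι κ : Type*} [Fintype ι] [DecidableEq ι] [Fintype κ]

/-- Bolzano–Weierstrass for the finitely many entries on matrix units. The construction controls the
image of one pure state only, whereas a closed thermal operation must be a limit on every input. -/
lemma exists_subseq_tendsto {Λs : ℕ → (Matrix ι ι ℂ →ₗ[ℂ] Matrix κ κ ℂ)} {C : ℝ}
    (hC : ∀ k i j a b, ‖Λs k (Matrix.single i j 1) a b‖ ≤ C) :
    ∃ (Λ : Matrix ι ι ℂ →ₗ[ℂ] Matrix κ κ ℂ) (φ : ℕ → ℕ), StrictMono φ ∧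
      ∀ X, Filter.Tendsto (fun k => Λs (φ k) X) Filter.atTop (𝓝 (Λ X)) := by
  let F : ℕ → (ι × ι × κ × κ → ℂ) := fun k x => Λs k (Matrix.single x.1 x.2.1 1) x.2.2.1 x.2.2.2
  have hF : ∀ k, F k ∈ Metric.closedBall (0 : ι × ι × κ × κ → ℂ) (max C 0) := by
    intro k
    rw [mem_closedBall_zero_iff, pi_norm_le_iff_of_nonneg (le_max_right _ _)]
    exact fun x => (hC k _ _ _ _).trans (le_max_left _ _)
  obtain ⟨G, -, φ, hφ, hG⟩ := (isCompact_closedBall _ _).tendsto_subseq hF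
  let Λ : Matrix ι ι ℂ →ₗ[ℂ] Matrix κ κ ℂ :=
    { toFun := fun X => ∑ i, ∑ j, X i j • Matrix.of fun a b => G (i, j, a, b)
      map_add' := fun X Y => by
        simp only [Matrix.add_apply, add_smul, Finset.sum_add_distrib]
      map_smul' := fun c X => by simp [mul_smul, Finset.smul_sum] }
  refine ⟨Λ, φ, hφ, fun X => ?_⟩
  have hX : ∀ k, Λs (φ k) X = ∑ i, ∑ j, X i j • Matrix.of fun a b => F (φ k) (i, j, a, b) := by
    intro k
    conv_lhs => rw [Matrix.matrix_eq_sum_single X]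
    simp only [map_sum]
    refine Finset.sum_congr rfl fun i _ => Finset.sum_congr rfl fun j _ => ?_
    have : (Matrix.of fun a b => F (φ k) (i, j, a, b)) = Λs (φ k) (Matrix.single i j 1) := rfl
    rw [this, ← map_smul, Matrix.smul_single, smul_eq_mul, mul_one]
  simp only [hX]
  refine tendsto_finsetSum _ fun i _ => tendsto_finsetSum _ fun j _ => ?_
  refine Filter.Tendsto.const_smul ?_ _
  exact tendsto_pi_nhds.2 fun a => tendsto_pi_nhds.2 fun b => tendsto_pi_nhds.1 hG (i, j, a, b)

end Compactness

/-! ### Permutation operations on pure inputs -/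

section PermOp

variable {β : ℝ} {A A' B B' : Sys Energies} {f : A.ι × B.ι ≃ A'.ι × B'.ι}

lemma permOp_apply (X : Matrix A.ι A.ι ℂ) (a a' : A'.ι) :
    permOp β B B' f X a a' = ∑ b, X (f.symm (a, b)).1 (f.symm (a', b)).1
      * gibbs β B.label (f.symm (a, b)).2 (f.symm (a', b)).2 := rfl

lemma norm_gibbs_le (b b' : B.ι) : ‖gibbs β B.label b b'‖ ≤ (gibbs β B.label b b).re := by
  have h0 : 0 ≤ Real.exp (-β * B.label b) / partition β B.label :=
    div_nonneg (Real.exp_pos _).le (partition_pos _ _).le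
  by_cases h : b = b'
  · subst h
    rw [gibbs_apply_self, Complex.norm_real, Complex.ofReal_re, Real.norm_of_nonneg h0]
  · rw [gibbs, Matrix.diagonal_apply_ne _ h, norm_zero, ← gibbs, gibbs_apply_self,
      Complex.ofReal_re]
    exact h0

/-- Each entry is bounded by a sum of Gibbs weights, and since `f` is a bijection the weights over
all outputs add up to `card A.ι`. The bound does not depend on the bath, as compactness requires. -/
lemma norm_permOp_single_le (i j : A.ι) (a a' : A'.ι) :
    ‖permOp β B B' f (Matrix.single i j 1) a a'‖ ≤ Fintype.card A.ι := by
  have hg : ∀ b, 0 ≤ (gibbs β B.label b b).re := fun b => (norm_nonneg _).trans (norm_gibbs_le b b)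
  have hs : ∀ x y, ‖(Matrix.single i j 1 : Matrix A.ι A.ι ℂ) x y‖ ≤ 1 := by
    intro x y
    rw [Matrix.single_apply]
    split_ifs <;> simp
  rw [permOp_apply]
  calc _ ≤ ∑ b, (gibbs β B.label (f.symm (a, b)).2 (f.symm (a, b)).2).re := by
        refine (norm_sum_le _ _).trans (Finset.sum_le_sum fun b _ => ?_)
        rw [norm_mul]
        exact (mul_le_of_le_one_left (norm_nonneg _) (hs _ _)).trans (norm_gibbs_le _ _)
    _ ≤ ∑ a, ∑ b, (gibbs β B.label (f.symm (a, b)).2 (f.symm (a, b)).2).re :=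
        Finset.single_le_sum
          (f := fun a => ∑ b, (gibbs β B.label (f.symm (a, b)).2 (f.symm (a, b)).2).re)
          (fun a _ => Finset.sum_nonneg fun b _ => hg _) (Finset.mem_univ a)
    _ = ∑ y : A.ι × B.ι, (gibbs β B.label y.2 y.2).re := by
        rw [← Fintype.sum_prod_type' (f := fun a b =>
          (gibbs β B.label (f.symm (a, b)).2 (f.symm (a, b)).2).re)]
        exact Equiv.sum_comp f.symm fun y => (gibbs β B.label y.2 y.2).re
    _ = Fintype.card A.ι := by
        have h := congrArg Complex.re (isState_gibbs β B.label).2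
        rw [Matrix.trace, Complex.re_sum, Complex.one_re] at h
        simp only [Matrix.diag_apply] at h
        rw [Fintype.sum_prod_type]
        simp only [h]
        simp

/-- A surviving term would need equal bath states and equal input states, hence equal images under
the bijection. So the output is diagonal. -/
lemma permOp_single_apply_ne (x₀ : A.ι) {a a' : A'.ι} (h : a ≠ a') :
    permOp β B B' f (Matrix.single x₀ x₀ 1) a a' = 0 := by
  rw [permOp_apply]
  refine Finset.sum_eq_zero fun b _ => ?_
  by_cases h2 : (f.symm (a, b)).2 = (f.symm (a', b)).2
  · by_cases h1 : (f.symm (a, b)).1 = (f.symm (a', b)).1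
    · exact absurd (congrArg Prod.fst (f.symm.injective (Prod.ext h1 h2))) h
    · rw [Matrix.single_apply, if_neg, zero_mul]
      rintro ⟨e1, e2⟩
      exact h1 (e1.symm.trans e2)
  · rw [gibbs, Matrix.diagonal_apply_ne _ h2, mul_zero]

lemma permOp_single_apply_self (x₀ : A.ι) (a : A'.ι) :
    permOp β B B' f (Matrix.single x₀ x₀ 1) a a =
      ((∑ b, if (f.symm (a, b)).1 = x₀ then
        Real.exp (-β * B.label (f.symm (a, b)).2) / partition β B.label else 0 : ℝ) : ℂ) := by
  rw [permOp_apply, Complex.ofReal_sum]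
  refine Finset.sum_congr rfl fun b _ => ?_
  rw [Matrix.single_apply, gibbs_apply_self]
  by_cases h : (f.symm (a, b)).1 = x₀
  · simp [h]
  · rw [if_neg h, if_neg fun h' => h h'.1.symm, zero_mul, Complex.ofReal_zero]

lemma trace_permOp (X : Matrix A.ι A.ι ℂ) : (permOp β B B' f X).trace = X.trace := by
  change (trSnd (relabel f (X ⊗ₖ gibbs β B.label))).trace = _
  rw [trace_trSnd]
  have : (relabel f (X ⊗ₖ gibbs β B.label)).trace = (X ⊗ₖ gibbs β B.label).trace :=
    Equiv.sum_comp f.symm fun y => (X ⊗ₖ gibbs β B.label) y y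
  rw [this, Matrix.trace_kronecker, (isState_gibbs β B.label).2, mul_one]

end PermOp

/-! ### The ladder bath and rounding estimates -/

section Ladder

/-- The basis of a bath with energy levels `0, …, K - 1`, the level `l` being `⌊K x ^ l⌋`-fold
degenerate. -/
abbrev LadderIndex (x : ℝ) (K : ℕ) : Type := Σ l : Fin K, Fin ⌊K * x ^ (l : ℕ)⌋₊

variable {x : ℝ} {K : ℕ}

lemma nonempty_ladderIndex (hK : 0 < K) : Nonempty (LadderIndex x K) := by
  refine ⟨⟨⟨0, hK⟩, ⟨0, ?_⟩⟩⟩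
  simpa using hK

lemma card_ladderIndex {κ : Type*} (k : κ → ℕ) {j : ℕ} (a : κ) (h : k a ≤ j) (hj : j < K) :
    Fintype.card {b : LadderIndex x K // k a + (b.1 : ℕ) = j} = ⌊K * x ^ (j - k a)⌋₊ := by
  have e : {b : LadderIndex x K // k a + (b.1 : ℕ) = j}
      ≃ {b : LadderIndex x K // b.1 = ⟨j - k a, by omega⟩} :=
    Equiv.subtypeEquivRight fun b => by
      rw [Fin.ext_iff]
      simp only
      omega
  rw [Fintype.card_congr (e.trans (Equiv.sigmaSubtype _)), Fintype.card_fin]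

/-- The partition function of the ladder. -/
def ladderSum (x : ℝ) (K : ℕ) : ℝ := ∑ b : LadderIndex x K, (x ^ (b.1 : ℕ))⁻¹

/-- The degeneracy cancels the Boltzmann factor: rounding loses at most `(x ^ l)⁻¹ ≤ 1`, so every
level contributes between `K - 1` and `K`. -/
lemma ladderSum_bounds (hx : 1 ≤ x) :
    (K : ℝ) * (K - 1) ≤ ladderSum x K ∧ ladderSum x K ≤ K * K := by
  have h : ladderSum x K = ∑ l : Fin K, (⌊K * x ^ (l : ℕ)⌋₊ : ℝ) * (x ^ (l : ℕ))⁻¹ := by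
    rw [ladderSum, Fintype.sum_sigma]
    simp
  have hpow : ∀ l : ℕ, 1 ≤ x ^ l := fun l => one_le_pow₀ hx
  rw [h]
  constructor
  · have : ∑ _l : Fin K, ((K : ℝ) - 1) = K * (K - 1) := by
      simp [mul_sub]
    rw [← this]
    refine Finset.sum_le_sum fun l _ => ?_
    have h1 := hpow l
    rw [← div_eq_mul_inv, le_div_iff₀ (by linarith)]
    have := (Nat.lt_floor_add_one ((K : ℝ) * x ^ (l : ℕ))).le
    nlinarith
  · have : ∑ _l : Fin K, (K : ℝ) = K * K := by simp
    rw [← this]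
    refine Finset.sum_le_sum fun l _ => ?_
    have h1 := hpow l
    rw [← div_eq_mul_inv, div_le_iff₀ (by linarith)]
    exact Nat.floor_le (by positivity)

/-- The share `r a` of the shell is rounded down and reduced by `N`. The floor in `m a` may lose 1,
so `⌊r a · ∑ m⌋ ≤ N (m a + 1)`, and the reduction restores the capacity bound `N * m a`. The total
error is independent of `j` and `K`. -/
lemma ladder_allocation_bounds {κ : Type*} [Fintype κ] {k : κ → ℕ} {r : κ → ℝ} {N j : ℕ}
    (hx : 1 ≤ x) (hr : ∀ a, 0 ≤ r a) (hr1 : ∑ a, r a = 1)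
    (hrN : ∀ a, r a * ∑ a', (x ^ k a')⁻¹ ≤ N * (x ^ k a)⁻¹) (hk : ∀ a, k a ≤ j) (hj : j < K) :
    let m : κ → ℕ := fun a => Fintype.card {b : LadderIndex x K // k a + (b.1 : ℕ) = j}
    let c : κ → ℕ := fun a => ⌊r a * (∑ a', m a' : ℕ)⌋₊ - N
    ∑ a, c a ≤ ∑ a, m a ∧ (∀ a, c a ≤ N * m a) ∧
      ∀ a, r a * (K * x ^ j * ∑ a', (x ^ k a')⁻¹) - (Fintype.card κ + 1 + N) ≤ c a := by
  intro m c
  have hx0 : 0 < x := by linarith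
  have hr1' : ∀ a, r a ≤ 1 := fun a =>
    hr1 ▸ Finset.single_le_sum (fun a _ => hr a) (Finset.mem_univ a)
  have hpow : ∀ a, (K : ℝ) * x ^ (j - k a) = K * x ^ j * (x ^ k a)⁻¹ := fun a => by
    rw [pow_sub₀ _ hx0.ne' (hk a), mul_assoc]
  have hm1 : ∀ a, (m a : ℝ) ≤ K * x ^ j * (x ^ k a)⁻¹ := fun a => by
    simp only [m]
    rw [card_ladderIndex k a (hk a) hj, ← hpow]
    exact Nat.floor_le (by positivity)
  have hm2 : ∀ a, K * x ^ j * (x ^ k a)⁻¹ ≤ (m a : ℝ) + 1 := fun a => by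
    simp only [m]
    rw [card_ladderIndex k a (hk a) hj, ← hpow]
    exact (Nat.lt_floor_add_one _).le
  have hn1 : ((∑ a, m a : ℕ) : ℝ) ≤ K * x ^ j * ∑ a', (x ^ k a')⁻¹ := by
    rw [Nat.cast_sum, Finset.mul_sum]
    exact Finset.sum_le_sum fun a _ => hm1 a
  have hn2 : K * x ^ j * ∑ a', (x ^ k a')⁻¹ ≤ ((∑ a, m a : ℕ) : ℝ) + Fintype.card κ := by
    rw [Nat.cast_sum, Finset.mul_sum]
    refine (Finset.sum_le_sum fun a _ => hm2 a).trans_eq ?_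
    rw [Finset.sum_add_distrib]
    simp
  have hfl : ∀ a, (⌊r a * (∑ a', m a' : ℕ)⌋₊ : ℝ) ≤ r a * (∑ a', m a' : ℕ) := fun a =>
    Nat.floor_le (mul_nonneg (hr a) (Nat.cast_nonneg _))
  refine ⟨?_, fun a => ?_, fun a => ?_⟩
  · have : ((∑ a, c a : ℕ) : ℝ) ≤ (∑ a, m a : ℕ) := by
      rw [Nat.cast_sum]
      calc ∑ a, (c a : ℝ) ≤ ∑ a, r a * (∑ a', m a' : ℕ) :=
            Finset.sum_le_sum fun a _ =>
              (Nat.cast_le.2 (Nat.sub_le _ _)).trans (hfl a)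
        _ = (∑ a, m a : ℕ) := by rw [← Finset.sum_mul, hr1, one_mul]
    exact_mod_cast this
  · refine Nat.sub_le_iff_le_add.2 (Nat.floor_le_of_le ?_)
    have h1 := mul_le_mul_of_nonneg_left hn1 (hr a)
    have h2 := mul_le_mul_of_nonneg_left (hrN a) (by positivity : 0 ≤ (K : ℝ) * x ^ j)
    have h3 := mul_le_mul_of_nonneg_left (hm2 a) (Nat.cast_nonneg (α := ℝ) N)
    push_cast at h1 ⊢
    linarith
  · have h1 := (Nat.lt_floor_add_one (r a * (∑ a', m a' : ℕ))).le
    have h2 : (⌊r a * (∑ a', m a' : ℕ)⌋₊ : ℝ) ≤ c a + N := by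
      exact_mod_cast (Nat.sub_le_iff_le_add.1 (le_refl (c a)))
    have h3 := mul_le_mul_of_nonneg_left hn2 (hr a)
    have h4 : r a * (Fintype.card κ : ℝ) ≤ Fintype.card κ :=
      mul_le_of_le_one_left (Nat.cast_nonneg _) (hr1' a)
    rw [mul_add] at h3
    linarith

end Ladder

/-! ### Exact preparation of dominated diagonal states -/

section SingleShot

variable {β : ℝ} {A A' : Sys Energies}

/-- The energies of a system lie on the ladder `e + ε ℕ`. -/
def OnLadder (ε : ℝ) (A : Sys Energies) (e : ℝ) (k : A.ι → ℕ) : Prop :=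
  ∀ a, A.label a = e + ε * k a

lemma exp_ladder (β ε e : ℝ) (j : ℕ) :
    Real.exp (-β * (e + ε * j)) = Real.exp (-β * e) * (Real.exp (β * ε) ^ j)⁻¹ := by
  rw [← Real.exp_nat_mul, ← Real.exp_neg, ← Real.exp_add]
  congr 1
  ring

lemma gibbs_ladder {ι : Type} [Fintype ι] {E : Energies ι} {ε e : ℝ} {k : ι → ℕ}
    (h : ∀ i, E i = e + ε * k i) (i : ι) :
    Real.exp (-β * E i) / partition β E
      = (Real.exp (β * ε) ^ k i)⁻¹ / ∑ i', (Real.exp (β * ε) ^ k i')⁻¹ := by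
  rw [partition]
  simp only [h, exp_ladder]
  rw [← Finset.mul_sum, mul_div_mul_left _ _ (Real.exp_pos _).ne']

/-- With the ladder bath, populations arbitrarily close to the desired ones are reached. -/
lemma exists_permOp_bound {ε e : ℝ} {k : A'.ι → ℕ} (hA : ∀ i, A.label i = 0)
    (hA' : OnLadder ε A' e k) (hβε : 0 ≤ β * ε) (x₀ : A.ι) {r : A'.ι → ℝ} (hr : ∀ a, 0 ≤ r a)
    (hr1 : ∑ a, r a = 1)
    (hrg : ∀ a, r a ≤ Fintype.card A.ι * (Real.exp (-β * A'.label a) / partition β A'.label))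
    {h K : ℕ} (hk : ∀ a, k a ≤ h) (hK : h ≤ K) (hK2 : 2 ≤ K) :
    ∃ (B B' : Sys Energies) (f : A.ι × B.ι ≃ A'.ι × B'.ι),
      (∀ y, addEnergies A'.label B'.label (f y) = addEnergies A.label B.label y) ∧
      ∃ P : A'.ι → ℝ, (∀ a, permOp β B B' f (Matrix.single x₀ x₀ 1) a a = (P a : ℂ)) ∧
        ∀ a, r a * ((K - h) / K) - (Fintype.card A'.ι + 1 + Fintype.card A.ι)
          / ((∑ a', (Real.exp (β * ε) ^ k a')⁻¹) * (K - 1)) ≤ P a := by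
  set x := Real.exp (β * ε) with hxdef
  have hx : 1 ≤ x := Real.one_le_exp hβε
  have hx0 : 0 < x := by linarith
  have : Nonempty (LadderIndex x K) := nonempty_ladderIndex (by omega)
  set Q : ℝ := ∑ a', (x ^ k a')⁻¹ with hQ
  have hQ0 : 0 < Q := Finset.sum_pos (fun _ _ => by positivity) Finset.univ_nonempty
  set N := Fintype.card A.ι with hN
  have hrN : ∀ a, r a * Q ≤ N * (x ^ k a)⁻¹ := by
    intro a
    have h1 := hrg a
    rw [gibbs_ladder hA', ← mul_div_assoc, le_div_iff₀ hQ0] at h1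
    exact h1
  let c : ℕ → A'.ι → ℕ := fun j a => ⌊r a * (∑ a' : A'.ι,
    Fintype.card {b : LadderIndex x K // k a' + (b.1 : ℕ) = j} : ℕ)⌋₊ - N
  -- Only for `h ≤ j < K` does every label `a` find its ladder level `j - k a`. The other shells are
  -- ignored, which costs the factor `(K - h) / K`.
  have hc : ∀ j ∈ Finset.Ico h K, _ := fun j hj => ladder_allocation_bounds (K := K) (k := k)
    (N := N) hx hr hr1 hrN (fun a => (hk a).trans (Finset.mem_Ico.1 hj).1) (Finset.mem_Ico.1 hj).2
  obtain ⟨f, hf, hfw⟩ := exists_allocation x₀ k (fun b : LadderIndex x K => (b.1 : ℕ))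
    (Finset.Ico h K) c (fun j hj => (hc j hj).1) (fun j hj => (hc j hj).2.1)
  -- Placing a copy of `A'` in the bath and leaving `A` in the waste makes both sides products of
  -- `A`, `A'` and the ladder, so their shells match.
  refine ⟨⟨A'.ι × LadderIndex x K, addEnergies A'.label fun b => ε * (b.1 : ℕ)⟩,
    ⟨A.ι × LadderIndex x K, addEnergies A.label fun b => ε * (b.1 : ℕ)⟩, f, fun y => ?_,
    _, fun a => permOp_single_apply_self x₀ a, fun a => ?_⟩
  · have h1 : ((k (f y).1 : ℝ) + ((f y).2.2.1 : ℕ)) = k y.2.1 + (y.2.2.1 : ℕ) := by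
      exact_mod_cast hf y
    simp only [addEnergies, hA, hA' _, zero_add]
    linear_combination ε * h1
  · obtain ⟨hY1, hY2⟩ := ladderSum_bounds (K := K) hx
    set Y := ladderSum x K with hY
    have hK' : (2 : ℝ) ≤ K := by exact_mod_cast hK2
    have hhK : (h : ℝ) ≤ K := by exact_mod_cast hK
    have hY0 : 0 < Y := lt_of_lt_of_le (by nlinarith) hY1
    have hg : ∀ b : A'.ι × LadderIndex x K,
        Real.exp (-β * (addEnergies A'.label (fun b : LadderIndex x K => ε * (b.1 : ℕ)) b))
          / partition β (addEnergies A'.label fun b : LadderIndex x K => ε * (b.1 : ℕ))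
        = (x ^ (k b.1 + (b.2.1 : ℕ)))⁻¹ / (Q * Y) := by
      intro b
      rw [gibbs_ladder (E := addEnergies A'.label fun b : LadderIndex x K => ε * (b.1 : ℕ))
        (k := fun b : A'.ι × LadderIndex x K => k b.1 + (b.2.1 : ℕ)) (e := e) (ε := ε)]
      · congr 1
        rw [hQ, hY, ladderSum, Finset.sum_mul_sum, Fintype.sum_prod_type]
        simp only [pow_add, mul_inv, ← hxdef]
      · intro i
        simp only [addEnergies, hA' _]
        push_cast
        ring
    have hw := hfw (fun j => (x ^ j)⁻¹ / (Q * Y)) (fun j => by positivity) a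
    have hPeq : (∑ b : A.ι × LadderIndex x K, if (f.symm (a, b)).1 = x₀ then
        (x ^ (k a + (b.2.1 : ℕ)))⁻¹ / (Q * Y) else 0) = ∑ b : A.ι × LadderIndex x K,
          if (f.symm (a, b)).1 = x₀ then
          Real.exp (-β * (addEnergies A'.label (fun b : LadderIndex x K => ε * (b.1 : ℕ))
            (f.symm (a, b)).2))
          / partition β (addEnergies A'.label fun b : LadderIndex x K => ε * (b.1 : ℕ)) else 0 := by
      refine Finset.sum_congr rfl fun b _ => ?_
      rw [hg, ← hf (f.symm (a, b)), Equiv.apply_symm_apply]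
    refine le_trans ?_ (hw.trans_eq hPeq)
    set D : ℝ := (Fintype.card A'.ι + 1 + N : ℝ) with hD
    have hD0 : 0 ≤ D := by positivity
    -- The weight `(x ^ j)⁻¹` cancels the shell's degeneracy `x ^ j`, so each shell contributes the
    -- same main term, and the rounding error is only damped.
    have hterm : ∀ j ∈ Finset.Ico h K,
        r a * K / Y - D / (Q * Y) ≤ (c j a : ℝ) * ((x ^ j)⁻¹ / (Q * Y)) := by
      intro j hj
      have h1 := (hc j hj).2.2 a
      have hxj : 1 ≤ x ^ j := one_le_pow₀ hx
      have h2 := mul_le_mul_of_nonneg_right h1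
        (by positivity : 0 ≤ (x ^ j)⁻¹ / (Q * Y))
      refine le_trans ?_ h2
      rw [sub_mul]
      have h3 : r a * (K * x ^ j * Q) * ((x ^ j)⁻¹ / (Q * Y)) = r a * K / Y := by
        field_simp
      have h4 : D * ((x ^ j)⁻¹ / (Q * Y)) ≤ D / (Q * Y) := by
        rw [mul_div_assoc']
        gcongr
        exact mul_le_of_le_one_right hD0 (inv_le_one_of_one_le₀ hxj)
      rw [h3]
      linarith
    refine le_trans ?_ (Finset.sum_le_sum hterm)
    rw [Finset.sum_const, Nat.card_Ico, nsmul_eq_mul, Nat.cast_sub hK]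
    have h5 : r a * ((K - h) / K) ≤ (K - h) * (r a * K / Y) := by
      rw [mul_div_assoc', mul_div_assoc', div_le_div_iff₀ (by linarith) hY0]
      have := mul_le_mul_of_nonneg_left hY2 (mul_nonneg (hr a) (sub_nonneg.2 hhK))
      linarith
    have h6 : (K - h) * (D / (Q * Y)) ≤ D / (Q * (K - 1)) := by
      rw [mul_div_assoc', div_le_div_iff₀ (by positivity)
        (mul_pos hQ0 (by linarith))]
      have h7 : ((K : ℝ) - h) * (K - 1) ≤ Y := by
        refine le_trans ?_ hY1
        have : (0 : ℝ) ≤ h := Nat.cast_nonneg h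
        nlinarith
      have := mul_le_mul_of_nonneg_left h7 (mul_nonneg hD0 hQ0.le)
      linarith
    rw [mul_sub ((K : ℝ) - h)]
    linarith

/-- If the populations `r` are at most `N` times those of the Gibbs state, then they are prepared
exactly by a thermal operation from a pure state of an `N`-fold degenerate system. -/
theorem exists_isThermal_diagonal {ε e : ℝ} {k : A'.ι → ℕ} (hA : ∀ i, A.label i = 0)
    (hA' : OnLadder ε A' e k) (hβε : 0 ≤ β * ε) (x₀ : A.ι) {r : A'.ι → ℝ} (hr : ∀ a, 0 ≤ r a)
    (hr1 : ∑ a, r a = 1)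
    (hrg : ∀ a, r a ≤ Fintype.card A.ι * (Real.exp (-β * A'.label a) / partition β A'.label)) :
    ∃ Λ, IsThermal β A A' Λ ∧
      Λ (Matrix.single x₀ x₀ 1) = Matrix.diagonal fun a => (r a : ℂ) := by
  obtain ⟨h, hk⟩ : ∃ h, ∀ a, k a ≤ h :=
    ⟨Finset.univ.sup k, fun a => Finset.le_sup (Finset.mem_univ a)⟩
  set Q : ℝ := ∑ a', (Real.exp (β * ε) ^ k a')⁻¹ with hQ
  have hQ0 : 0 < Q := Finset.sum_pos (fun _ _ => by positivity) Finset.univ_nonempty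
  set D : ℝ := Fintype.card A'.ι + 1 + Fintype.card A.ι with hD
  -- `K = n + h + 2` meets both `h ≤ K` and `2 ≤ K`.
  choose B B' f hf P hP hPr using fun n : ℕ =>
    exists_permOp_bound (β := β) hA hA' hβε x₀ hr hr1 hrg hk (K := n + h + 2) (by omega) (by omega)
  obtain ⟨Λ, φ, hφ, hΛ⟩ := exists_subseq_tendsto (Λs := fun n => permOp β (B n) (B' n) (f n))
    (C := Fintype.card A.ι) fun n => norm_permOp_single_le
  refine ⟨Λ, ⟨_, fun n => isThermalOp_permOp (hf (φ n)), hΛ⟩, ?_⟩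
  set L : ℕ → A'.ι → ℝ := fun n a =>
    r a * ((((n + h + 2 : ℕ) : ℝ) - h) / (n + h + 2 : ℕ)) - D / (Q * ((n + h + 2 : ℕ) - 1)) with hLdef
  have hN : Filter.Tendsto (fun n : ℕ => ((n + h + 2 : ℕ) : ℝ)) Filter.atTop Filter.atTop :=
    tendsto_natCast_atTop_atTop.comp (Filter.tendsto_add_atTop_nat (h + 2))
  have hL : ∀ a, Filter.Tendsto (fun n => L n a) Filter.atTop (𝓝 (r a)) := by
    intro a
    have h1 : Filter.Tendsto (fun n : ℕ => (((n + h + 2 : ℕ) : ℝ) - h) / (n + h + 2 : ℕ))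
        Filter.atTop (𝓝 (1 - 0)) := by
      have : ∀ n : ℕ, (((n + h + 2 : ℕ) : ℝ) - h) / (n + h + 2 : ℕ)
          = 1 - h / (n + h + 2 : ℕ) := fun n => by
        rw [sub_div, div_self (by positivity)]
      simp only [this]
      exact tendsto_const_nhds.sub (hN.const_div_atTop _)
    have h2 : Filter.Tendsto (fun n : ℕ => D / (Q * (((n + h + 2 : ℕ) : ℝ) - 1)))
        Filter.atTop (𝓝 0) :=
      Filter.Tendsto.const_div_atTop
        ((Filter.tendsto_atTop_add_const_right _ (-1) hN).const_mul_atTop hQ0) _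
    have := (h1.const_mul (r a)).sub h2
    rwa [sub_zero, sub_zero, mul_one] at this
  have hsum : ∀ n, ∑ a, P n a = 1 := by
    intro n
    have h1 := trace_permOp (β := β) (B := B n) (B' := B' n) (f := f n) (Matrix.single x₀ x₀ 1)
    rw [Matrix.trace_single_eq_same, Matrix.trace] at h1
    simp only [Matrix.diag_apply, hP] at h1
    exact_mod_cast h1
  -- Only lower bounds are known. As the populations sum to 1, the excess of one over its bound is
  -- at most `1 - ∑ L`, which tends to 0.
  have hPlim : ∀ a, Filter.Tendsto (fun n => P n a) Filter.atTop (𝓝 (r a)) := by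
    intro a
    have hup : Filter.Tendsto (fun n => L n a + (1 - ∑ a', L n a')) Filter.atTop
        (𝓝 (r a + (1 - ∑ a', r a'))) :=
      (hL a).add (tendsto_const_nhds.sub (tendsto_finsetSum _ fun a' _ => hL a'))
    rw [hr1, sub_self, add_zero] at hup
    refine tendsto_of_tendsto_of_tendsto_of_le_of_le (hL a) hup (fun n => hPr n a) fun n => ?_
    have h1 := Finset.single_le_sum (f := fun a' => P n a' - L n a')
      (fun a' _ => sub_nonneg.2 (hPr n a')) (Finset.mem_univ a)
    rw [Finset.sum_sub_distrib, hsum] at h1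
    linarith
  have hlim := hΛ (Matrix.single x₀ x₀ 1)
  ext a a'
  have h1 := tendsto_pi_nhds.1 (tendsto_pi_nhds.1 hlim a) a'
  by_cases haa : a = a'
  · subst haa
    rw [Matrix.diagonal_apply_eq]
    refine tendsto_nhds_unique h1 ?_
    simp only [hP]
    exact (Complex.continuous_ofReal.tendsto _).comp ((hPlim a).comp hφ.tendsto_atTop)
  · rw [Matrix.diagonal_apply_ne _ haa]
    refine tendsto_nhds_unique h1 ?_
    simp only [permOp_single_apply_ne x₀ haa]
    exact tendsto_const_nhds

end SingleShot

open Theory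

/-! ### Diagonal states -/

section Diagonal

variable {ι : Type*} [DecidableEq ι]

/-- The diagonal matrix with real entries `r`. -/
abbrev realDiag (r : ι → ℝ) : Matrix ι ι ℂ := Matrix.diagonal fun i => (r i : ℂ)

lemma realDiag_apply_eq (r : ι → ℝ) (i : ι) : realDiag r i i = (r i : ℂ) :=
  Matrix.diagonal_apply_eq _ _

lemma realDiag_apply_ne (r : ι → ℝ) {i j : ι} (h : i ≠ j) : realDiag r i j = 0 :=
  Matrix.diagonal_apply_ne _ h

lemma smul_realDiag_sub (s : ℝ) (r g : ι → ℝ) :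
    (s : ℂ) • realDiag g - realDiag r = realDiag fun i => s * g i - r i := by
  ext i j
  by_cases h : i = j
  · subst h
    simp
  · simp [h]

lemma posSemidef_realDiag_iff {r : ι → ℝ} : (realDiag r).PosSemidef ↔ ∀ i, 0 ≤ r i := by
  rw [Matrix.posSemidef_diagonal_iff]
  simp only [Complex.zero_le_real]

lemma posSemidef_smul_realDiag_sub_iff {s : ℝ} {r g : ι → ℝ} :
    ((s : ℂ) • realDiag g - realDiag r).PosSemidef ↔ ∀ i, r i ≤ s * g i := by
  rw [smul_realDiag_sub, posSemidef_realDiag_iff]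
  simp only [sub_nonneg]

lemma isState_realDiag_iff [Fintype ι] {r : ι → ℝ} :
    IsState (realDiag r) ↔ (∀ i, 0 ≤ r i) ∧ ∑ i, r i = 1 := by
  rw [IsState, posSemidef_realDiag_iff, Matrix.trace_diagonal, ← Complex.ofReal_sum,
    ← Complex.ofReal_one, Complex.ofReal_inj]

lemma exists_eq_realDiag {ρ : Matrix ι ι ℂ} (hρ : ρ.PosSemidef) (hd : ρ.IsDiag) :
    ∃ r : ι → ℝ, ρ = realDiag r := by
  refine ⟨fun i => (ρ i i).re, ?_⟩
  ext i j
  by_cases h : i = j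
  · subst h
    rw [realDiag_apply_eq]
    exact Complex.eq_re_of_ofReal_le (r := 0) (by simpa using hρ.diag_nonneg (i := i))
  · rw [realDiag_apply_ne _ h]
    exact hd h

lemma Dmax_realDiag {r g : ι → ℝ} {s : ℝ} (hs : 0 < s) (h : ∀ i, r i ≤ s * g i) {i₀ : ι}
    (hg : 0 < g i₀) (hi : r i₀ = s * g i₀) :
    Dmax (realDiag r) (realDiag g) = (Real.logb 2 s : ℝ) := by
  refine le_antisymm (Dmax_le hs (posSemidef_smul_realDiag_sub_iff.2 h))
    (le_Dmax_of_forall fun t _ ht => ?_)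
  have := posSemidef_smul_realDiag_sub_iff.1 ht i₀
  rw [hi] at this
  exact EReal.coe_le_coe_iff.2
    (Real.logb_le_logb_of_le one_lt_two hs (le_of_mul_le_mul_right this hg))

end Diagonal

/-! ### The work cost of semiclassical states -/

section Achievability

variable {β : ℝ}

/-- The populations of the Gibbs state. -/
def gibbsProb {ι : Type} [Fintype ι] (β : ℝ) (E : Energies ι) (i : ι) : ℝ :=
  Real.exp (-β * E i) / partition β E

lemma exists_powState_realDiag {T : Theory} {A : Sys T.Label} {r g : A.ι → ℝ} {s : ℝ}
    (hr : ∀ i, 0 ≤ r i) (h : ∀ i, r i ≤ s * g i) (n : ℕ) :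
    ∃ r' g' : (pow A n).ι → ℝ, powState (realDiag r) n = realDiag r' ∧
      powState (realDiag g) n = realDiag g' ∧ (∀ x, 0 ≤ r' x) ∧ ∀ x, r' x ≤ s ^ n * g' x := by
  induction n with
  | zero =>
    have h1 : (1 : Matrix Unit Unit ℂ) = realDiag fun _ => 1 := by
      ext i j
      simp [realDiag]
    exact ⟨fun _ => 1, fun _ => 1, h1, h1, fun _ => zero_le_one, fun _ => by simp⟩
  | succ n ih =>
    obtain ⟨r', g', hr', hg', h0, hle⟩ := ih
    have hk : ∀ (u : (pow A n).ι → ℝ) (v : A.ι → ℝ),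
        realDiag u ⊗ₖ realDiag v = realDiag fun x => u x.1 * v x.2 := fun u v => by
      rw [realDiag, realDiag, Matrix.diagonal_kronecker_diagonal]
      congr 1
      ext x
      simp
    refine ⟨fun x => r' x.1 * r x.2, fun x => g' x.1 * g x.2,
      (congrArg (· ⊗ₖ realDiag r) hr').trans (hk r' r),
      (congrArg (· ⊗ₖ realDiag g) hg').trans (hk g' g),
      fun x => mul_nonneg (h0 _) (hr _), fun x => ?_⟩
    calc r' x.1 * r x.2 ≤ (s ^ n * g' x.1) * (s * g x.2) :=
          mul_le_mul (hle _) (h _) (hr _) ((h0 _).trans (hle _))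
      _ = s ^ (n + 1) * (g' x.1 * g x.2) := by ring

lemma onLadder_pow {ε e : ℝ} {A : Sys (thermo β).Label} {k : A.ι → ℕ}
    (h : OnLadder ε A e k) (n : ℕ) : ∃ e' k', OnLadder ε (pow A n) e' k' := by
  induction n with
  | zero => exact ⟨0, fun _ => 0, fun _ => by rw [Nat.cast_zero, mul_zero, add_zero]; rfl⟩
  | succ n ih =>
    obtain ⟨e', k', h'⟩ := ih
    refine ⟨e' + e, fun x => k' x.1 + k x.2, fun x => ?_⟩
    refine (congrArg₂ (· + ·) (h' x.1) (h x.2)).trans ?_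
    push_cast
    ring

/-- Rounding `n log₂ s` up to an integer costs at most `1/n < δ` per copy. -/
lemma exists_rate {s δ : ℝ} (hs : 1 ≤ s) (hδ : 0 < δ) :
    ∃ m n : ℕ, 0 < n ∧ (m : ℝ) / n ≤ Real.logb 2 s + δ ∧ s ^ n ≤ 2 ^ m := by
  obtain ⟨n, hn⟩ := exists_nat_gt (1 / δ)
  have hn0 : (0 : ℝ) < n := lt_trans (by positivity) hn
  have hl := Real.logb_nonneg one_lt_two hs
  refine ⟨⌈n * Real.logb 2 s⌉₊, n, by exact_mod_cast hn0, ?_, ?_⟩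
  · rw [div_le_iff₀ hn0]
    have h1 := (Nat.ceil_lt_add_one (mul_nonneg hn0.le hl)).le
    rw [div_lt_iff₀ hδ] at hn
    linarith
  · have h1 : (2 : ℝ) ^ (n * Real.logb 2 s) ≤ (2 : ℝ) ^ (⌈n * Real.logb 2 s⌉₊ : ℝ) :=
      Real.rpow_le_rpow_of_exponent_le one_le_two (Nat.le_ceil _)
    rw [Real.rpow_natCast, mul_comm (n : ℝ), Real.rpow_mul zero_le_two,
      Real.rpow_logb two_pos (by norm_num) (by linarith), Real.rpow_natCast,
      mul_comm _ (n : ℝ)] at h1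
    exact h1

/-- Tensor powers of the populations satisfy `r^{⊗n} ≤ s ^ n g^{⊗n} ≤ 2 ^ m g^{⊗n}`, and copies stay
on a ladder of the same step, so the single-shot preparation applies to `n` copies at once. -/
theorem achievable_of_le {ε e : ℝ} {A : Sys (thermo β).Label} {k : A.ι → ℕ}
    (hA : OnLadder ε A e k) (hβε : 0 ≤ β * ε) {ρ : Matrix A.ι A.ι ℂ} (hρ : IsState ρ)
    (hd : ρ.IsDiag) {s : ℝ} (h : ((s : ℂ) • gibbs β A.label - ρ).PosSemidef) :
    Achievable (T := thermo β) (workBit β) ρ (Real.logb 2 s) := by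
  have hs : 1 ≤ s := hρ.one_le_of_le (isState_gibbs β A.label) h
  obtain ⟨r, rfl⟩ := exists_eq_realDiag hρ.1 hd
  have hle := posSemidef_smul_realDiag_sub_iff (g := gibbsProb β A.label).1 h
  intro δ hδ
  obtain ⟨m, n, hn, hmn, hsm⟩ := exists_rate hs hδ
  obtain ⟨r', g', hr', hg', h0, hle'⟩ :=
    exists_powState_realDiag (A := A) (isState_realDiag_iff.1 hρ).1 hle n
  have hgn : realDiag (gibbsProb β (pow A n).label) = realDiag g' := (gibbs_pow A n).trans hg'
  have hgn' : ∀ x, gibbsProb β (pow A n).label x = g' x := fun x =>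
    Complex.ofReal_injective (congrFun (Matrix.diagonal_injective hgn) x)
  have hsum : ∑ x, r' x = 1 :=
    (isState_realDiag_iff.1 (hr' ▸ isState_powState (T := thermo β) hρ n)).2
  obtain ⟨e', k', hA'⟩ := onLadder_pow hA n
  obtain ⟨x₀, hx₀⟩ := exists_powState_workBit β m
  have hcard : ((Fintype.card (pow (qubit β 0) m).ι : ℕ) : ℝ) = 2 ^ m := by
    rw [card_pow]
    have : Fintype.card (qubit β 0).ι = 2 := Fintype.card_fin 2
    rw [this]
    push_cast
    rfl
  obtain ⟨Λ, hΛ, hΛr⟩ := exists_isThermal_diagonal (A := pow (qubit β 0) m) (A' := pow A n)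
    (label_pow_workBit m) hA' hβε x₀ h0 hsum fun x => by
      have hg0 : 0 ≤ gibbsProb β (pow A n).label x :=
        div_nonneg (Real.exp_pos _).le (partition_pos _ _).le
      rw [hcard]
      refine (hle' x).trans ?_
      rw [← hgn']
      exact mul_le_mul_of_nonneg_right hsm hg0
  exact ⟨m, n, hn, hmn, Λ, hΛ, by rw [hx₀, hΛr, hr']⟩

/-- The exact work cost of a semiclassical state is its max-relative entropy to the Gibbs state. -/
theorem cost_eq_Dmax {ε e : ℝ} {A : Sys (thermo β).Label} {k : A.ι → ℕ}
    (hA : OnLadder ε A e k) (hβε : 0 ≤ β * ε) {ρ : Matrix A.ι A.ι ℂ} (hρ : IsState ρ)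
    (hd : ρ.IsDiag) :
    cost (T := thermo β) (workBit β) ρ = Dmax ρ (gibbs β A.label) := by
  apply le_antisymm
  · exact le_Dmax_of_forall fun s _ h => iInf₂_le _ (achievable_of_le hA hβε hρ hd h)
  · refine le_iInf₂ fun t ht => ?_
    obtain ⟨r, rfl⟩ := exists_eq_realDiag hρ.1 hd
    have h := posSemidef_smul_realDiag_sub_iff (s := (2 : ℝ) ^ t) (r := r)
      (g := gibbsProb β A.label).2 fun i => by
        have := apply_le_of_achievable hρ.1 ht i
        rw [realDiag_apply_eq, Complex.ofReal_re] at this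
        exact this.trans_eq (congrArg _ ((congrArg Complex.re
          (gibbs_apply_self β A.label i)).trans (Complex.ofReal_re _)))
    refine (Dmax_le (by positivity) h).trans_eq ?_
    rw [Real.logb_rpow two_pos (by norm_num)]

end Achievability

/-! ### The two-level example -/

section TwoLevel

variable {β p : ℝ} {E : Fin 2 → ℝ}

lemma onLadder_qubit (β : ℝ) (E : Fin 2 → ℝ) :
    OnLadder (E 1 - E 0) (qubit β E) (E 0) (fun i => (i : Fin 2).val) := by
  intro i
  change E i = E 0 + (E 1 - E 0) * ((i : Fin 2).val : ℝ)
  revert i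
  change ∀ i : Fin 2, _
  intro i
  fin_cases i <;> simp

lemma onLadder_qubit_tensor (β : ℝ) (E : Fin 2 → ℝ) :
    OnLadder (E 1 - E 0) (tensor (qubit β E) (qubit β E)) (E 0 + E 0)
      (fun i => (i.1 : Fin 2).val + (i.2 : Fin 2).val) := by
  intro i
  refine (congrArg₂ (· + ·) (onLadder_qubit β E i.1) (onLadder_qubit β E i.2)).trans ?_
  push_cast
  ring

lemma gap_nonneg (hp : p < 1 / 2) (hγ : realDiag ![1 - p, p] = gibbs β E) :
    0 ≤ β * (E 1 - E 0) := by
  have h : ∀ i, ![1 - p, p] i = gibbsProb β E i := fun i =>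
    Complex.ofReal_injective (congrFun (Matrix.diagonal_injective hγ) i)
  have h0 : 1 - p = gibbsProb β E 0 := h 0
  have h1 : p = gibbsProb β E 1 := h 1
  have hlt : gibbsProb β E 1 ≤ gibbsProb β E 0 := by rw [← h0, ← h1]; linarith
  have hle := (div_le_div_iff_of_pos_right (partition_pos β E)).1 hlt
  rw [Real.exp_le_exp] at hle
  linarith

lemma workCost_eq_Dmax (hp : p < 1 / 2) (hγ : realDiag ![1 - p, p] = gibbs β E)
    {ρ : Matrix (Fin 2) (Fin 2) ℂ} (hρ : IsState ρ) (hd : ρ.IsDiag) :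
    workCost β E ρ = Dmax ρ (realDiag ![1 - p, p]) := by
  rw [hγ]
  exact cost_eq_Dmax (onLadder_qubit β E) (gap_nonneg hp hγ) hρ hd

lemma ket0_eq : ket0 = realDiag ![1, 0] := by
  ext i j
  fin_cases i <;> fin_cases j <;> simp [ket0]

lemma segment_eq (p q : ℝ) :
    ((1 - q : ℝ) : ℂ) • ket0 + (q : ℂ) • realDiag ![1 - p, p]
      = realDiag ![1 - p * q, p * q] := by
  rw [ket0_eq]
  ext i j
  fin_cases i <;> fin_cases j <;> simp <;> ring

lemma workCost_segment (hp0 : 0 < p) (hp : p < 1 / 2) (hγ : realDiag ![1 - p, p] = gibbs β E)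
    {q : ℝ} (hq0 : 0 ≤ q) (hq1 : q ≤ 1) :
    workCost β E (((1 - q : ℝ) : ℂ) • ket0 + (q : ℂ) • realDiag ![1 - p, p])
      = ((Real.logb 2 ((1 - p * q) / (1 - p)) : ℝ) : EReal) := by
  have hpq : p * q ≤ p := mul_le_of_le_one_right hp0.le hq1
  have hpq0 : 0 ≤ p * q := mul_nonneg hp0.le hq0
  rw [segment_eq, workCost_eq_Dmax hp hγ]
  · refine Dmax_realDiag (i₀ := 0) (div_pos (by linarith) (by linarith)) (fun i => ?_) ?_ ?_
    · fin_cases i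
      · simp only [Fin.zero_eta, Matrix.cons_val_zero]
        rw [div_mul_cancel₀ _ (by linarith)]
      · simp only [Fin.mk_one, Matrix.cons_val_one, Matrix.cons_val_fin_one]
        rw [div_mul_eq_mul_div, le_div_iff₀ (by linarith)]
        nlinarith
    · simp only [Matrix.cons_val_zero]
      linarith
    · simp only [Matrix.cons_val_zero]
      rw [div_mul_cancel₀ _ (by linarith)]
  · rw [isState_realDiag_iff]
    refine ⟨fun i => ?_, by simp⟩
    fin_cases i
    · simp only [Fin.zero_eta, Matrix.cons_val_zero]
      linarith
    · simpa using hpq0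
  · exact Matrix.isDiag_diagonal _

lemma half_logb_lt_of_lt (hp0 : 0 < p) (hp : p < 1 / 2) :
    1 / 2 * Real.logb 2 (1 / (1 - p)) < Real.logb 2 ((1 - p * (1 / 2)) / (1 - p)) := by
  have h1 : (0 : ℝ) < 1 - p := by linarith
  -- With `s = 1/(1 - p)`, the optimal factor for the ground state, `(s + 1)/2` is the factor of the
  -- mixture.
  convert half_logb_lt (s := 1 / (1 - p)) ?_ using 2
  · field_simp
    ring
  · rw [lt_div_iff₀ h1]
    linarith

lemma mix_eq (ρ σ : Matrix (Fin 2) (Fin 2) ℂ) :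
    mix ρ σ = ((1 - 1 / 2 : ℝ) : ℂ) • ρ + ((1 / 2 : ℝ) : ℂ) • σ := by
  rw [mix]
  push_cast
  norm_num

/-- The symmetrised product of the ground and Gibbs states is diagonal and at most `1/(1 - p)` times
the Gibbs state of the pair, so it is prepared at rate `log₂ (1/(1 - p))`; catalysis turns each pair
into two copies. -/
lemma catWorkCost_mix_le (hp0 : 0 < p) (hp : p < 1 / 2)
    (hγ : realDiag ![1 - p, p] = gibbs β E) :
    catWorkCost β E (mix ket0 (realDiag ![1 - p, p]))
      ≤ ((1 / 2 * Real.logb 2 (1 / (1 - p)) : ℝ) : EReal) := by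
  have h1 : (0 : ℝ) < 1 - p := by linarith
  have hket : IsState ket0 := by
    rw [ket0_eq, isState_realDiag_iff]
    refine ⟨fun i => ?_, by simp⟩
    fin_cases i <;> simp
  have hγs : IsState (realDiag ![1 - p, p]) := by
    rw [hγ]
    exact isState_gibbs β E
  have hpsd : (((1 / (1 - p) : ℝ) : ℂ) • realDiag ![1 - p, p] - ket0).PosSemidef := by
    rw [ket0_eq, posSemidef_smul_realDiag_sub_iff]
    intro i
    fin_cases i
    · simp only [Fin.zero_eta, Matrix.cons_val_zero]
      rw [div_mul_cancel₀ _ h1.ne']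
    · simp only [Fin.mk_one, Matrix.cons_val_one, Matrix.cons_val_fin_one]
      positivity
  have hω := symProd_le hγs.1 hpsd
  have hdiag : (symProd ket0 (realDiag ![1 - p, p])).IsDiag := by
    rw [ket0_eq]
    exact (((Matrix.isDiag_diagonal _).kronecker (Matrix.isDiag_diagonal _)).smul _).add
      (((Matrix.isDiag_diagonal _).kronecker (Matrix.isDiag_diagonal _)).smul _)
  have hG : realDiag ![1 - p, p] ⊗ₖ realDiag ![1 - p, p] = gibbs β (addEnergies E E) := by
    rw [gibbs_addEnergies, hγ]
  rw [hG] at hω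
  have hach := achievable_of_le (A := tensor (qubit β E) (qubit β E))
    (onLadder_qubit_tensor β E) (gap_nonneg hp hγ) (hket.symProd hγs) hdiag hω
  have hcat := (thermo_hasRearrangements β).catAchievable_of_achievable (A := qubit β E)
    (hket.mix hγs) (trSnd_symProd hket hγs) (trFst_symProd hket hγs) hach
  refine (catCost_le hcat).trans_eq ?_
  congr 1
  ring

end TwoLevel

end QResource

end

/-! ### Assembly of the three statements -/

theorem mainTheorem6 :
    -- the two-level example
    (∀ (β p : ℝ) (E : Fin 2 → ℝ) (γ : Matrix (Fin 2) (Fin 2) ℂ), 0 < β → 0 < p → p < 1 / 2 →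
      γ = Matrix.diagonal ![((1 - p : ℝ) : ℂ), ((p : ℝ) : ℂ)] → γ = gibbs β E →
      -- the exact work cost of semiclassical states, and its values on the segment
      (∀ ρ : Matrix (Fin 2) (Fin 2) ℂ, IsState ρ → ρ.IsDiag → workCost β E ρ = Dmax ρ γ) ∧
      workCost β E ket0 = ((Real.logb 2 (1 / (1 - p)) : ℝ) : EReal) ∧
      workCost β E γ = 0 ∧
      (∀ q : ℝ, 0 ≤ q → q ≤ 1 →
        workCost β E (((1 - q : ℝ) : ℂ) • ket0 + (q : ℂ) • γ)
          = ((Real.logb 2 ((1 - p * q) / (1 - p)) : ℝ) : EReal)) ∧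
      -- failure of midpoint convexity, and the catalytic advantage
      ((1 / 2 : ℝ) : EReal) * workCost β E ket0 + ((1 / 2 : ℝ) : EReal) * workCost β E γ
        < workCost β E (mix ket0 γ) ∧
      catWorkCost β E (mix ket0 γ) < workCost β E (mix ket0 γ)) ∧
    -- an arbitrary set `S` of states: failure of midpoint convexity of `D_max(·‖S)`
    (∀ {ι : Type} [Fintype ι] (S : Set (Matrix ι ι ℂ)) (ρ σ : Matrix ι ι ℂ),
      (∀ ω ∈ S, IsState ω) → IsState ρ → ρ ∉ S → σ ∈ S →
      Dmax ρ σ = DmaxSet ρ S → DmaxSet ρ S < ⊤ →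
      ((1 / 2 : ℝ) : EReal) * DmaxSet ρ S + ((1 / 2 : ℝ) : EReal) * DmaxSet σ S
        < DmaxSet (mix ρ σ) S) ∧
    -- an arbitrary resource theory whose exact cost is `D_max(·‖S)` on a class `𝒞` of states
    (∀ (T : Theory), T.IsResourceTheory →
      ∀ (Ω : Sys T.Label) (Φ : Matrix Ω.ι Ω.ι ℂ), IsState Φ →
      ∀ (𝒞 : ∀ A : Sys T.Label, Set (Matrix A.ι A.ι ℂ)),
      (∀ (A B : Sys T.Label) (ρ : Matrix A.ι A.ι ℂ) (σ : Matrix B.ι B.ι ℂ),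
        ρ ∈ 𝒞 A → σ ∈ 𝒞 B → Matrix.kroneckerMap (· * ·) ρ σ ∈ 𝒞 (Theory.tensor A B)) →
      (∀ (A : Sys T.Label) (ρ σ : Matrix A.ι A.ι ℂ), ρ ∈ 𝒞 A → σ ∈ 𝒞 A → mix ρ σ ∈ 𝒞 A) →
      (∀ (A : Sys T.Label) (ρ : Matrix A.ι A.ι ℂ), IsState ρ → ρ ∈ 𝒞 A →
        Theory.cost Φ ρ = DmaxSet ρ (T.freeStates A)) →
      ∀ (A : Sys T.Label) (ρ σ : Matrix A.ι A.ι ℂ), IsState ρ → ρ ∈ 𝒞 A →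
        ρ ∉ T.freeStates A → σ ∈ 𝒞 A → σ ∈ T.freeStates A →
        Dmax ρ σ = DmaxSet ρ (T.freeStates A) → DmaxSet ρ (T.freeStates A) < ⊤ →
        ((1 / 2 : ℝ) : EReal) * Theory.cost Φ ρ + ((1 / 2 : ℝ) : EReal) * Theory.cost Φ σ
          < Theory.cost Φ (mix ρ σ) ∧
        Theory.catCost Φ (mix ρ σ) < Theory.cost Φ (mix ρ σ)) := by
  refine ⟨fun β p E γ _ hp0 hp hγ hγβ => ?_, fun S ρ σ hS hρ hρS hσ hopt hfin =>
    half_DmaxSet_lt hS hρ hρS hσ hopt hfin, fun T hT Ω Φ _ 𝒞 htensor hmix hcost A ρ σ hρ hρ𝒞 hρS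
    hσ𝒞 hσ hopt hfin => cost_mix_and_catCost_mix hT htensor hmix hcost hρ hρ𝒞 hρS hσ𝒞 hσ hopt hfin⟩
  have hγd : γ = realDiag ![1 - p, p] := by
    rw [hγ]
    congr 1
    ext i
    fin_cases i <;> simp
  subst hγd
  have hseg := fun q => workCost_segment (q := q) hp0 hp hγβ
  have h0 := hseg 0 le_rfl zero_le_one
  have h1 := hseg 1 zero_le_one le_rfl
  have h2 := hseg (1 / 2) (by norm_num) (by norm_num)
  rw [← mix_eq] at h2
  simp only [sub_zero, Complex.ofReal_one, one_smul, Complex.ofReal_zero, zero_smul, add_zero,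
    mul_zero] at h0
  simp only [sub_self, Complex.ofReal_one, one_smul, Complex.ofReal_zero, zero_smul, zero_add,
    mul_one] at h1
  rw [div_self (by linarith), Real.logb_one, EReal.coe_zero] at h1
  have hlt := EReal.coe_lt_coe_iff.2 (half_logb_lt_of_lt hp0 hp)
  refine ⟨fun ρ hρ hd => workCost_eq_Dmax hp hγβ hρ hd, h0, h1, hseg, ?_, ?_⟩
  · rw [h0, h1, h2, mul_zero, add_zero, ← EReal.coe_mul]
    exact hlt
  · rw [h2]
    exact (catWorkCost_mix_le hp0 hp hγβ).trans_lt hlt
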